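/- Let $N\ge 2$ be an integer and let $g:\mathbb R\to\mathbb R$ be continuous and odd, differentiable at $0$ with $g'(0)>0$, and such that for some $\alpha\in(0,+\infty]$ one has $g>0$ on $(0,\alpha)$ and $g<0$ on $(\alpha,+\infty)$. Put $G(t)=\int_0^t g(s)\,ds$. Then for every $\xi\in\mathbb R$ there exist $R_\xi\in(0,+\infty]$ and a solution $u_\xi\in C^2([0,R_\xi))$ of the Cauchy problem $$-\left(\frac{u'}{\sqrt{1+(u')^2}}\right)'-\frac{N-1}{r}\,\frac{u'}{\sqrt{1+(u')^2}}=g(u)\quad\text{in }(0,R_\xi),\qquad u(0)=\xi,\quad u'(0)=0,$$ which is maximal, i.e. cannot be extended to a $C^2$ solution on $[0,R')$ for any $R'>R_\xi$, and which has the following properties. (i) If $|\xi|=\alpha<+\infty$ or $\xi=0$, then $u_\xi\equiv\xi$. (ii) If $\alpha<+\infty$ and $|\xi|>\alpha$, then $|u_\xi|$ is strictly increasing on $[0,R_\xi)$, and $|u_\xi(r)|\to+\infty$ or $|u_\xi'(r)|\to+\infty$ as $r\to R_\xi^-$. (iii) If $0<|\xi|<\alpha$ and $G(\xi)\le 1$,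 then $R_\xi=+\infty$; moreover $u_\xi$ is oscillating (it has an unbounded sequence of zeros) and localized ($u_\xi(r)$, $u_\xi'(r)$ and $u_\xi''(r)$ tend to $0$ as $r\to+\infty$), and $\|u_\xi\|_{L^\infty((0,+\infty))}=|\xi|$. -/

import Mathlib

namespace RadialMeanCurvature

open Set Filter Topology MeasureTheory

/-- The interval `[0, R)` for an endpoint `R ∈ (0, +∞]`. -/
def interval (R : EReal) : Set ℝ := {r : ℝ | 0 ≤ r ∧ (r : EReal) < R}

/-- The derivative `u'` of a function `u` on `[0, R)` (one-sided at `0`). -/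
noncomputable def prime (R : EReal) (u : ℝ → ℝ) : ℝ → ℝ := derivWithin u (interval R)

/-- The quantity `u' / √(1 + (u')²)`. -/
noncomputable def flux (R : EReal) (u : ℝ → ℝ) (r : ℝ) : ℝ :=
  prime R u r / Real.sqrt (1 + (prime R u r) ^ 2)

/-- `u` is a `C²` solution on `[0, R)` of the Cauchy problem
`-(u'/√(1+(u')²))' - ((N-1)/r) u'/√(1+(u')²) = g(u)`, `u(0) = ξ`, `u'(0) = 0`,
where the equation holds at every `r ∈ (0, R)`.
The values of `u` outside `[0, R)` play no role. -/
structure IsSolution (N : ℕ) (g : ℝ → ℝ) (ξ : ℝ) (R : EReal) (u : ℝ → ℝ) : Prop where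
  endpoint_pos : 0 < R
  contDiffOn : ContDiffOn ℝ 2 u (interval R)
  equation : ∀ r ∈ interval R, 0 < r →
    -(prime R (flux R u) r) - ((N : ℝ) - 1) / r * flux R u r = g (u r)
  initial_value : u 0 = ξ
  initial_slope : prime R u 0 = 0

/-- `u` is a solution on `[0, R)` which cannot be continued as a solution
to any larger interval `[0, R')`. -/
def IsMaximalSolution (N : ℕ) (g : ℝ → ℝ) (ξ : ℝ) (R : EReal) (u : ℝ → ℝ) : Prop :=
  IsSolution N g ξ R u ∧
    ∀ (R' : EReal) (v : ℝ → ℝ), R < R' → IsSolution N g ξ R' v → ¬ EqOn v u (interval R)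

/-- The filter `r → R⁻` on the real line; for `R = +∞` this is `r → +∞`. -/
noncomputable def leftLimit (R : EReal) : Filter ℝ := comap (fun r : ℝ => (r : EReal)) (𝓝[<] R)

/-- A function on `[0, +∞)` is oscillating if it has an unbounded sequence of zeros. -/
def IsOscillating (u : ℝ → ℝ) : Prop :=
  ∃ z : ℕ → ℝ, (∀ n, 0 ≤ z n ∧ u (z n) = 0) ∧ ¬ BddAbove (range z)

/-- A function on `[0, +∞)` is localized if it converges to zero at infinity together with
its derivatives up to order two. -/
def IsLocalized (u : ℝ → ℝ) : Prop :=
  Tendsto u atTop (𝓝 0) ∧ Tendsto (prime ⊤ u) atTop (𝓝 0) ∧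
    Tendsto (prime ⊤ (prime ⊤ u)) atTop (𝓝 0)

/-- The `L^∞` norm on `(0, +∞)`. -/
noncomputable def supNorm (u : ℝ → ℝ) : ENNReal := eLpNorm u ⊤ (volume.restrict (Ioi (0 : ℝ)))

end RadialMeanCurvature

namespace RadialMeanCurvature

open Set Filter Topology MeasureTheory

/-! Write `n = N - 1` and let `v = u' / √(1 + u'²)` be the flux, so that `|v| < 1` and `u' = v / √(1
- v²)`. The equation reads `(rⁿ v)' = -rⁿ g(u)`. Integrating from `0` determines `v(r)` from the
values of `u` on `[0, r]` (`forcedFlux`), and the problem becomes the causal first-order equation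
`u' = v / √(1 - v²)`, with no singularity left at `r = 0`.

Since `g` is only continuous, existence is of Peano type: the inverse flux is truncated, the
resulting bounded equation is solved by delayed approximations (`exists_causal_extension`), and the
truncation is inactive as long as `|v| < c < 1`. Zorn's lemma then yields a maximal solution. If `u`
extends continuously to a finite endpoint, then `|v|` must reach `1` there
(`one_le_abs_forcedFlux`).

For `ξ > α`, the solution stays where `g < 0`, so `v > 0` and `u` increases. If `u` is bounded, the
integral formula would force `v ≥ 1` at some finite radius, so `R` is finite; `u` then has a limit
at `R`, the flux is saturated and `u'` blows up (`blow_up`).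

For `0 < ξ < α`, the energy `E = 1 - √(1 - v²) + G(u)` satisfies `E' = -(n/r) u' v ≤ 0`. It traps
`|u| ≤ ξ`, and since it drops strictly below `G(ξ) ≤ 1` at once, it keeps `v` away from `±1`; hence
`R = ∞`. A Prüfer angle rotates at a rate bounded below, which gives the zeros (`exists_zero_ge`). A
corrected energy with a logarithmic term shows `E → 0` (`exists_energy_lt_of_pos`), from which `u`,
`u'` and `u''` tend to `0`. Oddness of `g` covers `ξ < 0`. -/

/-! ### Integral form of the flux. -/

/-- The weighted average `∫₀¹ tⁿ g(u(rt)) dt`, equal to `r⁻⁽ⁿ⁺¹⁾ ∫₀ʳ sⁿ g(u(s)) ds` for `r > 0`. -/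
noncomputable def radialAverage (n : ℕ) (g u : ℝ → ℝ) (r : ℝ) : ℝ :=
  ∫ t in (0 : ℝ)..1, t ^ n * g (u (r * t))

/-- The flux `u' / √(1 + (u')²)` forced by the values of `u` on `[0, r]`. -/
noncomputable def forcedFlux (n : ℕ) (g u : ℝ → ℝ) (r : ℝ) : ℝ := -(r * radialAverage n g u r)

/-- The inverse `v ↦ v / √(1 - v²)` of the flux, precomposed with the projection to `[-c, c]`. -/
noncomputable def clampedSlope (c v : ℝ) : ℝ :=
  max (-c) (min c v) / Real.sqrt (1 - (max (-c) (min c v)) ^ 2)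

lemma continuous_radialAverage {n : ℕ} {g u : ℝ → ℝ} (hg : Continuous g) (hu : Continuous u) :
    Continuous (radialAverage n g u) := by
  unfold radialAverage
  apply intervalIntegral.continuous_parametric_intervalIntegral_of_continuous'
  fun_prop

lemma continuous_forcedFlux {n : ℕ} {g u : ℝ → ℝ} (hg : Continuous g) (hu : Continuous u) :
    Continuous (forcedFlux n g u) :=
  (continuous_id.mul (continuous_radialAverage hg hu)).neg

lemma radialAverage_congr {n : ℕ} {g u w : ℝ → ℝ} {r : ℝ} (hr : 0 ≤ r)
    (h : EqOn u w (Icc 0 r)) : radialAverage n g u r = radialAverage n g w r := by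
  refine intervalIntegral.integral_congr fun t ht => ?_
  rw [uIcc_of_le zero_le_one] at ht
  have : u (r * t) = w (r * t) :=
    h ⟨mul_nonneg hr ht.1, mul_le_of_le_one_right hr ht.2⟩
  simp only [this]

lemma forcedFlux_congr {n : ℕ} {g u w : ℝ → ℝ} {r : ℝ} (hr : 0 ≤ r)
    (h : EqOn u w (Icc 0 r)) : forcedFlux n g u r = forcedFlux n g w r := by
  rw [forcedFlux, forcedFlux, radialAverage_congr hr h]

@[simp] lemma forcedFlux_zero (n : ℕ) (g u : ℝ → ℝ) : forcedFlux n g u 0 = 0 := by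
  simp [forcedFlux]

lemma pow_mul_radialAverage {n : ℕ} {g u : ℝ → ℝ} (r : ℝ) :
    r ^ n * (r * radialAverage n g u r) = ∫ s in (0 : ℝ)..r, s ^ n * g (u s) := by
  have h := intervalIntegral.mul_integral_comp_mul_left (a := 0) (b := 1)
    (f := fun s => s ^ n * g (u s)) r
  rw [mul_zero, mul_one] at h
  rw [← h, radialAverage, mul_left_comm, ← intervalIntegral.integral_const_mul]
  congr 2
  ext t
  ring

lemma pow_mul_forcedFlux {n : ℕ} {g u : ℝ → ℝ} (r : ℝ) :
    r ^ n * forcedFlux n g u r = -∫ s in (0 : ℝ)..r, s ^ n * g (u s) := by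
  rw [forcedFlux, ← pow_mul_radialAverage, mul_neg]

lemma radialAverage_zero (n : ℕ) (g u : ℝ → ℝ) :
    radialAverage n g u 0 = g (u 0) / (n + 1) := by
  simp [radialAverage, intervalIntegral.integral_mul_const, integral_pow]
  ring

/-- Away from `0` this is the quotient rule for `r⁻ⁿ ∫₀ʳ sⁿ g(u)`. At `0` the difference quotient of
`r * radialAverage` is `radialAverage` itself, and the formula agrees there because `radialAverage n
g u 0 = g (u 0) / (n + 1)`. -/
lemma hasDerivAt_forcedFlux {n : ℕ} {g u : ℝ → ℝ} (hg : Continuous g) (hu : Continuous u)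
    (r : ℝ) : HasDerivAt (forcedFlux n g u) (-(g (u r) - n * radialAverage n g u r)) r := by
  refine HasDerivAt.neg ?_
  rcases eq_or_ne r 0 with rfl | hr
  · have h : g (u 0) - n * radialAverage n g u 0 = radialAverage n g u 0 := by
      rw [radialAverage_zero]
      field_simp
      ring
    rw [h, hasDerivAt_iff_tendsto_slope]
    have hc := (continuous_radialAverage (n := n) hg hu).tendsto 0
    refine (hc.mono_left nhdsWithin_le_nhds).congr' ?_
    filter_upwards [self_mem_nhdsWithin] with x hx
    have hx : x ≠ 0 := hx
    simp [slope_def_field, hx]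
  · have hint : HasDerivAt (fun x => ∫ s in (0 : ℝ)..x, s ^ n * g (u s)) (r ^ n * g (u r)) r :=
      intervalIntegral.integral_hasDerivAt_right
        ((by fun_prop : Continuous fun s => s ^ n * g (u s)).intervalIntegrable _ _)
        ((by fun_prop : Continuous fun s => s ^ n * g (u s)).stronglyMeasurableAtFilter _ _)
        (by fun_prop : Continuous fun s => s ^ n * g (u s)).continuousAt
    have hq := hint.div (hasDerivAt_pow n r) (pow_ne_zero n hr)
    have he : (fun x => x * radialAverage n g u x) =ᶠ[𝓝 r]
        (fun x => (∫ s in (0 : ℝ)..x, s ^ n * g (u s)) / x ^ n) := by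
      filter_upwards [isOpen_ne.mem_nhds hr] with x hx
      have hx : x ≠ 0 := hx
      rw [← pow_mul_radialAverage, mul_div_cancel_left₀ _ (pow_ne_zero n hx)]
    refine (hq.congr_of_eventuallyEq he).congr_deriv ?_
    rw [← pow_mul_radialAverage]
    rcases n with _ | n
    · simp
    · simp only [Nat.add_sub_cancel]
      field_simp
      ring

/-! ### The map between slope and flux, and its truncation. -/

lemma abs_clamp_le {c : ℝ} (hc : 0 ≤ c) (v : ℝ) : |max (-c) (min c v)| ≤ c := by
  rw [abs_le]
  exact ⟨le_max_left _ _, max_le (by linarith) (min_le_left _ _)⟩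

lemma one_sub_clamp_sq_pos {c : ℝ} (hc : 0 ≤ c) (hc1 : c < 1) (v : ℝ) :
    0 < 1 - (max (-c) (min c v)) ^ 2 := by
  have h := abs_clamp_le hc v
  have : (max (-c) (min c v)) ^ 2 < 1 := by
    rw [← sq_abs]
    nlinarith [abs_nonneg (max (-c) (min c v))]
  linarith

lemma continuous_clampedSlope {c : ℝ} (hc : 0 ≤ c) (hc1 : c < 1) :
    Continuous (clampedSlope c) := by
  unfold clampedSlope
  refine Continuous.div (by fun_prop) (by fun_prop) fun v => ?_
  exact (Real.sqrt_pos.2 (one_sub_clamp_sq_pos hc hc1 v)).ne'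

lemma abs_clampedSlope_le {c : ℝ} (hc : 0 ≤ c) (hc1 : c < 1) (v : ℝ) :
    |clampedSlope c v| ≤ c / Real.sqrt (1 - c ^ 2) := by
  have h := abs_clamp_le hc v
  have hs : 0 < 1 - c ^ 2 := by nlinarith
  rw [clampedSlope, abs_div, abs_of_nonneg (Real.sqrt_nonneg _)]
  refine div_le_div₀ hc h (Real.sqrt_pos.2 hs) (Real.sqrt_le_sqrt ?_)
  have : (max (-c) (min c v)) ^ 2 ≤ c ^ 2 := sq_le_sq' (abs_le.1 h).1 (abs_le.1 h).2
  linarith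

lemma clampedSlope_of_abs_le {c v : ℝ} (h : |v| ≤ c) :
    clampedSlope c v = v / Real.sqrt (1 - v ^ 2) := by
  rw [abs_le] at h
  rw [clampedSlope, min_eq_right h.2, max_eq_right h.1]

lemma slope_div_sqrt {v : ℝ} (h : |v| < 1) :
    v / Real.sqrt (1 - v ^ 2) / Real.sqrt (1 + (v / Real.sqrt (1 - v ^ 2)) ^ 2) = v := by
  have hs : 0 < 1 - v ^ 2 := by
    have := (sq_lt_one_iff_abs_lt_one v).2 h
    linarith
  have h1 : 1 + (v / Real.sqrt (1 - v ^ 2)) ^ 2 = 1 / (1 - v ^ 2) := by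
    rw [div_pow, Real.sq_sqrt hs.le]
    field_simp
    ring
  have hp := Real.sqrt_pos.2 hs
  rw [h1, Real.sqrt_div zero_le_one, Real.sqrt_one]
  field_simp

lemma slope_of_flux (p : ℝ) :
    p / Real.sqrt (1 + p ^ 2) /
      Real.sqrt (1 - (p / Real.sqrt (1 + p ^ 2)) ^ 2) = p := by
  have hs : 0 < 1 + p ^ 2 := by positivity
  have h1 : 1 - (p / Real.sqrt (1 + p ^ 2)) ^ 2 = 1 / (1 + p ^ 2) := by
    rw [div_pow, Real.sq_sqrt hs.le]
    field_simp
    ring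
  have hp := Real.sqrt_pos.2 hs
  rw [h1, Real.sqrt_div zero_le_one, Real.sqrt_one]
  field_simp

lemma abs_flux_lt_one (p : ℝ) : |p / Real.sqrt (1 + p ^ 2)| < 1 := by
  have hs : 0 < Real.sqrt (1 + p ^ 2) := Real.sqrt_pos.2 (by positivity)
  rw [abs_div, abs_of_pos hs, div_lt_one hs]
  refine Real.lt_sqrt_of_sq_lt ?_
  rw [sq_abs]
  linarith

lemma strictMono_flux : StrictMono fun p : ℝ => p / Real.sqrt (1 + p ^ 2) := by
  have hd : ∀ p : ℝ, 0 < Real.sqrt (1 + p ^ 2) := fun p => Real.sqrt_pos.2 (by positivity)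
  refine strictMono_of_deriv_pos fun p => ?_
  have hs : (0 : ℝ) < 1 + p ^ 2 := by positivity
  have h1 : HasDerivAt (fun p : ℝ => Real.sqrt (1 + p ^ 2))
      (2 * p / (2 * Real.sqrt (1 + p ^ 2))) p := by
    have := ((hasDerivAt_pow 2 p).const_add 1).sqrt hs.ne'
    simpa using this
  have h2 : HasDerivAt (fun p : ℝ => p / Real.sqrt (1 + p ^ 2)) _ p :=
    (hasDerivAt_id p).div h1 (hd p).ne'
  rw [h2.deriv]
  have h3 := Real.sq_sqrt hs.le
  have h4 := hd p
  apply div_pos _ (by positivity)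
  simp only [id]
  have : 1 * Real.sqrt (1 + p ^ 2) - p * (2 * p / (2 * Real.sqrt (1 + p ^ 2))) =
      1 / Real.sqrt (1 + p ^ 2) := by
    field_simp
    linarith
  rw [this]
  positivity

/-! ### Peano existence for causal equations. -/

/-- Equi-Lipschitz functions that are bounded at one point subconverge pointwise. -/
lemma exists_subseq_tendsto_of_lipschitz {K : NNReal} {U : ℕ → ℝ → ℝ} {a : ℝ}
    (hU : ∀ m, LipschitzWith K (U m)) (h0 : ∀ m, U m 0 = a) :
    ∃ (w : ℝ → ℝ) (φ : ℕ → ℕ), StrictMono φ ∧ LipschitzWith K w ∧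
      ∀ r, Tendsto (fun m => U (φ m) r) atTop (𝓝 (w r)) := by
  -- Compactness of a countable product over `ℚ` replaces a diagonal extraction; the common
  -- Lipschitz constant carries convergence from `ℚ` to `ℝ`.
  have hcpt : IsCompact (univ.pi fun q : ℚ => Metric.closedBall a (K * |(q : ℝ)|)) :=
    isCompact_univ_pi fun q => isCompact_closedBall _ _
  obtain ⟨v, -, φ, hφ, hv⟩ := hcpt.tendsto_subseq (x := fun m (q : ℚ) => U m q) fun m q _ => by
    rw [Metric.mem_closedBall, ← h0 m]
    have := (hU m).dist_le_mul (q : ℝ) 0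
    rwa [Real.dist_0_eq_abs] at this
  rw [tendsto_pi_nhds] at hv
  have hc : ∀ r, CauchySeq fun m => U (φ m) r := by
    intro r
    rw [Metric.cauchySeq_iff']
    intro ε hε
    have hK : (0 : ℝ) < K + 1 := by positivity
    obtain ⟨q, hq1, hq2⟩ := exists_rat_btwn (show r < r + ε / (3 * (K + 1)) by
      linarith [show (0 : ℝ) < ε / (3 * (K + 1)) by positivity])
    obtain ⟨M, hM⟩ := Metric.cauchySeq_iff'.1 (hv q).cauchySeq (ε / 3) (by positivity)
    refine ⟨M, fun m hm => ?_⟩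
    have hd : ∀ j, dist (U (φ j) r) (U (φ j) q) ≤ ε / 3 := by
      intro j
      refine ((hU (φ j)).dist_le_mul r q).trans ?_
      have h1 : dist r (q : ℝ) ≤ ε / (3 * (K + 1)) := by
        rw [Real.dist_eq, abs_sub_comm, abs_of_pos (by linarith)]
        linarith
      calc (K : ℝ) * dist r q ≤ (K + 1) * (ε / (3 * (K + 1))) := by gcongr; linarith
        _ = ε / 3 := by field_simp
    have h2 := hM m hm
    simp only [Function.comp_apply] at h2
    calc dist (U (φ m) r) (U (φ M) r) ≤ dist (U (φ m) r) (U (φ m) q) +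
          dist (U (φ m) q) (U (φ M) q) + dist (U (φ M) q) (U (φ M) r) := dist_triangle4 _ _ _ _
      _ < ε / 3 + ε / 3 + ε / 3 := by
          have := hd M
          rw [dist_comm] at this
          linarith [hd m]
      _ = ε := by ring
  choose w hw using fun r => cauchySeq_tendsto_of_complete (hc r)
  refine ⟨w, φ, hφ, LipschitzWith.of_dist_le_mul fun x y => ?_, hw⟩
  exact le_of_tendsto ((hw x).dist (hw y)) (Eventually.of_forall fun m => (hU _).dist_le_mul x y)

/-- Primitive of `f` from `b`, delayed by `h` and vanishing before time `b + h`. -/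
lemma lipschitzWith_delayed_primitive {f : ℝ → ℝ} (hf : Continuous f) {M : NNReal}
    (hM : ∀ s, |f s| ≤ M) (b h : ℝ) :
    LipschitzWith M fun r => ∫ s in b..max (r - h) b, f s := by
  refine LipschitzWith.of_dist_le_mul fun x y => ?_
  rw [Real.dist_eq, intervalIntegral.integral_interval_sub_left
    (hf.intervalIntegrable _ _) (hf.intervalIntegrable _ _), ← Real.norm_eq_abs]
  refine (intervalIntegral.norm_integral_le_of_norm_le_const fun s _ => hM s).trans ?_
  gcongr
  refine (abs_max_sub_max_le_abs _ _ _).trans ?_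
  rw [sub_sub_sub_cancel_right, Real.dist_eq]

/-- Peano's theorem for `u' = T u` where `T` is a bounded, causal and continuous operator,
starting from a solution given on `[0, b]`. -/
theorem exists_causal_extension {T : (ℝ → ℝ) → ℝ → ℝ} {M : NNReal}
    (hbd : ∀ u r, |T u r| ≤ M)
    (hcont : ∀ u, Continuous u → Continuous (T u))
    (hcausal : ∀ u w r, 0 ≤ r → EqOn u w (Icc 0 r) → T u r = T w r)
    (hlim : ∀ (K : NNReal) (U : ℕ → ℝ → ℝ) (w : ℝ → ℝ) (a : ℝ), (∀ m, LipschitzWith K (U m)) →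
      (∀ m, U m 0 = a) → (∀ r, Tendsto (fun m => U m r) atTop (𝓝 (w r))) → Continuous w →
      ∀ r, Tendsto (fun m => T (U m) r) atTop (𝓝 (T w r)))
    {b : ℝ} (hb : 0 ≤ b) {u₀ : ℝ → ℝ} (hu₀ : Continuous u₀)
    (heq : ∀ r ∈ Icc 0 b, u₀ r = u₀ 0 + ∫ s in (0 : ℝ)..r, T u₀ s) :
    ∃ w : ℝ → ℝ, Continuous w ∧ EqOn w u₀ (Icc 0 b) ∧
      ∀ r ∈ Icc 0 (b + 1), w r = u₀ 0 + ∫ s in (0 : ℝ)..r, T w s := by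
  -- `v` is the given solution, frozen outside `[0, b]`.
  set v : ℝ → ℝ := fun r => u₀ (max 0 (min r b)) with hv
  have hv_lip : LipschitzWith M v := by
    have h1 : LipschitzOnWith M u₀ (Icc 0 b) := by
      refine LipschitzOnWith.of_dist_le_mul fun x hx y hy => ?_
      rw [heq x hx, heq y hy, dist_add_left, Real.dist_eq,
        intervalIntegral.integral_interval_sub_left ((hcont _ hu₀).intervalIntegrable _ _)
          ((hcont _ hu₀).intervalIntegrable _ _), ← Real.norm_eq_abs]
      exact intervalIntegral.norm_integral_le_of_norm_le_const fun s _ => hbd _ s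
    refine LipschitzWith.of_dist_le_mul fun x y => ?_
    have hmem : ∀ x : ℝ, max 0 (min x b) ∈ Icc 0 b := fun x =>
      ⟨le_max_left _ _, max_le hb (min_le_right _ _)⟩
    refine (h1.dist_le_mul _ (hmem x) _ (hmem y)).trans ?_
    gcongr
    rw [Real.dist_eq, Real.dist_eq, max_comm, max_comm 0]
    exact (abs_max_sub_max_le_abs _ _ _).trans (abs_min_sub_min_le_max _ _ _ _ |>.trans (by simp))
  have hv0 : v 0 = u₀ 0 := by simp [hv, hb]
  have hvu : EqOn v u₀ (Icc 0 b) := fun r hr => by simp [hv, hr.1, hr.2]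
  have hvb : ∀ r, b ≤ r → v r = u₀ b := fun r hr => by simp [hv, hr, hb]
  -- The delayed Picard map: past `b`, `D h u r` sees `u` only up to `r - h`, so its iterates become
  -- exactly stationary instead of needing a contraction.
  set D : ℝ → (ℝ → ℝ) → ℝ → ℝ := fun h u r => v r + ∫ s in b..max (r - h) b, T u s with hD
  have hD_lip : ∀ h u, Continuous u → LipschitzWith (M + M) (D h u) := fun h u hu =>
    hv_lip.add (lipschitzWith_delayed_primitive (hcont u hu) (hbd u) b h)
  set h : ℕ → ℝ := fun m => 1 / ((m : ℝ) + 1) with hh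
  have hh_pos : ∀ m, 0 < h m := fun m => by positivity
  set V : ℕ → ℕ → ℝ → ℝ := fun m j => (D (h m))^[j] v with hV
  have hV_succ : ∀ m j, V m (j + 1) = D (h m) (V m j) := fun m j =>
    Function.iterate_succ_apply' _ _ _
  have hV_cont : ∀ m j, Continuous (V m j) := by
    intro m j
    induction j with
    | zero => exact hv_lip.continuous
    | succ j ih => rw [hV_succ]; exact (hD_lip _ _ ih).continuous
  -- Each iteration lengthens the stationary region by the delay `h m`. As `(m + 1) * h m = 1`, the
  -- iterate `m + 1` is a fixed point up to `b + 1`.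
  have hV_stab : ∀ m (j : ℕ) r, r ≤ b + j * h m → V m (j + 1) r = V m j r := by
    intro m j
    induction j with
    | zero =>
      intro r hr
      have : max (r - h m) b = b := max_eq_right (by
        have := hh_pos m
        simp only [Nat.cast_zero, zero_mul, add_zero] at hr
        linarith)
      rw [hV_succ]
      simp [hD, this, hV]
    | succ j ih =>
      intro r hr
      rw [hV_succ m (j + 1), hV_succ m j]
      simp only [hD]
      congr 1
      refine intervalIntegral.integral_congr fun s hs => ?_
      rw [uIcc_of_le (le_max_right _ _)] at hs
      refine hcausal _ _ s (hb.trans hs.1) fun x hx => ?_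
      have hVx := ih x (hx.2.trans (hs.2.trans (max_le ?_ ?_)))
      · rwa [hV_succ] at hVx
      · push_cast at hr
        linarith
      · have := (hh_pos m).le
        nlinarith [show (0 : ℝ) ≤ j * h m by positivity]
  set W : ℕ → ℝ → ℝ := fun m => V m (m + 1) with hW
  have hW_lip : ∀ m, LipschitzWith (M + M) (W m) := fun m => by
    simp only [hW, hV_succ]
    exact hD_lip _ _ (hV_cont _ _)
  have hW_fix : ∀ m r, r ≤ b + 1 → W m r = v r + ∫ s in b..max (r - h m) b, T (W m) s := by
    intro m r hr
    have h1 := hV_stab m (m + 1) r (by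
      have : ((m + 1 : ℕ) : ℝ) * h m = 1 := by
        simp only [hh]
        push_cast
        field_simp
      rwa [this])
    rw [← hW] at *
    change V m (m + 1) r = _
    rw [← h1, hV_succ]
  have hW0 : ∀ m, W m 0 = u₀ 0 := by
    intro m
    rw [hW_fix m 0 (by linarith), max_eq_right (by linarith [hh_pos m]), hv0]
    simp
  obtain ⟨w, φ, hφ, hw_lip, hw⟩ := exists_subseq_tendsto_of_lipschitz hW_lip hW0
  have hTw := hlim _ (fun m => W (φ m)) w _ (fun m => hW_lip _) (fun m => hW0 _) hw
    hw_lip.continuous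
  have hw_eq : ∀ r ≤ b + 1, w r = v r + ∫ s in b..max r b, T w s := by
    intro r hr
    have ha : Tendsto (fun m => ∫ s in b..max r b, T (W (φ m)) s) atTop
        (𝓝 (∫ s in b..max r b, T w s)) := by
      refine intervalIntegral.tendsto_integral_filter_of_dominated_convergence (fun _ => (M : ℝ))
        (Eventually.of_forall fun m => ((hcont _ (hW_lip _).continuous).aestronglyMeasurable))
        (Eventually.of_forall fun m => Eventually.of_forall fun s _ => hbd _ _)
        intervalIntegrable_const (Eventually.of_forall fun s _ => hTw s)
    -- The delay changes the integral by at most `M * h`, so it disappears in the limit.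
    have hz : Tendsto (fun m => ∫ s in max (r - h (φ m)) b..max r b, T (W (φ m)) s) atTop
        (𝓝 0) := by
      have hhz : Tendsto (fun m => (M : ℝ) * h (φ m)) atTop (𝓝 0) := by
        rw [← mul_zero (M : ℝ)]
        exact (tendsto_one_div_add_atTop_nhds_zero_nat.comp hφ.tendsto_atTop).const_mul _
      refine squeeze_zero_norm (fun m => ?_) hhz
      refine (intervalIntegral.norm_integral_le_of_norm_le_const fun s _ => hbd _ s).trans ?_
      gcongr
      refine (abs_max_sub_max_le_abs _ _ _).trans ?_
      rw [sub_sub_cancel, abs_of_pos (hh_pos _)]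
    have hsum := (ha.sub hz).const_add (v r)
    rw [sub_zero] at hsum
    refine tendsto_nhds_unique (hw r) (hsum.congr fun m => ?_)
    have hi : ∀ x y, IntervalIntegrable (T (W (φ m))) volume x y := fun x y =>
      (hcont _ (hW_lip _).continuous).intervalIntegrable x y
    rw [hW_fix _ r hr, ← intervalIntegral.integral_add_adjacent_intervals
      (hi b (max (r - h (φ m)) b)) (hi _ (max r b)), add_sub_cancel_right]
  have hwu : EqOn w u₀ (Icc 0 b) := by
    intro r hr
    rw [hw_eq r (hr.2.trans (by linarith)), max_eq_right hr.2, hvu hr]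
    simp
  refine ⟨w, hw_lip.continuous, hwu, fun r hr => ?_⟩
  have hT_eq : ∀ r ∈ Icc 0 b, ∫ s in (0 : ℝ)..r, T u₀ s = ∫ s in (0 : ℝ)..r, T w s := by
    intro r hr
    refine intervalIntegral.integral_congr fun s hs => ?_
    rw [uIcc_of_le hr.1] at hs
    exact hcausal _ _ s hs.1 fun x hx => (hwu ⟨hx.1, hx.2.trans (hs.2.trans hr.2)⟩).symm
  rcases le_total r b with hrb | hrb
  · rw [hwu ⟨hr.1, hrb⟩, heq r ⟨hr.1, hrb⟩, hT_eq r ⟨hr.1, hrb⟩]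
  · have hi : ∀ x y, IntervalIntegrable (T w) volume x y := fun x y =>
      (hcont _ hw_lip.continuous).intervalIntegrable x y
    rw [hw_eq r hr.2, max_eq_left hrb, hvb r hrb, heq b ⟨hb, le_rfl⟩, hT_eq b ⟨hb, le_rfl⟩,
      add_assoc, intervalIntegral.integral_add_adjacent_intervals (hi _ _) (hi _ _)]

/-- Dominated convergence: the common Lipschitz constant and initial value confine all `U m (r * t)`
to one compact ball, where `g` is bounded. -/
lemma tendsto_radialAverage {n : ℕ} {g : ℝ → ℝ} (hg : Continuous g) {K : NNReal}
    {U : ℕ → ℝ → ℝ} {w : ℝ → ℝ} {a : ℝ} (hU : ∀ m, LipschitzWith K (U m)) (h0 : ∀ m, U m 0 = a)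
    (hw : ∀ r, Tendsto (fun m => U m r) atTop (𝓝 (w r))) (r : ℝ) :
    Tendsto (fun m => radialAverage n g (U m) r) atTop (𝓝 (radialAverage n g w r)) := by
  obtain ⟨C, hC⟩ := (isCompact_closedBall a (K * |r|)).exists_bound_of_continuousOn
    hg.continuousOn
  refine intervalIntegral.tendsto_integral_filter_of_dominated_convergence (fun _ => C)
    (Eventually.of_forall fun m => ?_) (Eventually.of_forall fun m =>
      Eventually.of_forall fun t ht => ?_) intervalIntegrable_const
    (Eventually.of_forall fun t _ => ?_)
  · have := (hU m).continuous
    exact (by fun_prop : Continuous fun t => t ^ n * g (U m (r * t))).aestronglyMeasurable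
  · rw [uIoc_of_le zero_le_one] at ht
    rw [norm_mul, norm_pow, Real.norm_eq_abs, abs_of_pos ht.1]
    have h1 : ‖g (U m (r * t))‖ ≤ C := by
      refine hC _ ?_
      rw [Metric.mem_closedBall, ← h0 m]
      refine ((hU m).dist_le_mul _ _).trans ?_
      gcongr
      rw [Real.dist_0_eq_abs, abs_mul, abs_of_pos ht.1]
      exact mul_le_of_le_one_right (abs_nonneg r) ht.2
    exact (mul_le_of_le_one_left (norm_nonneg _) (pow_le_one₀ ht.1.le ht.2)).trans h1
  · exact ((hg.tendsto _).comp (hw _)).const_mul _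

/-- Local existence for the truncated equation, starting from a solution given on `[0, b]`. -/
theorem exists_clamped_extension {n : ℕ} {g : ℝ → ℝ} (hg : Continuous g) {c : ℝ} (hc : 0 ≤ c)
    (hc1 : c < 1) {b : ℝ} (hb : 0 ≤ b) {u₀ : ℝ → ℝ} (hu₀ : Continuous u₀)
    (heq : ∀ r ∈ Icc 0 b, u₀ r = u₀ 0 + ∫ s in (0 : ℝ)..r, clampedSlope c (forcedFlux n g u₀ s)) :
    ∃ w : ℝ → ℝ, Continuous w ∧ EqOn w u₀ (Icc 0 b) ∧
      ∀ r ∈ Icc 0 (b + 1),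
        w r = u₀ 0 + ∫ s in (0 : ℝ)..r, clampedSlope c (forcedFlux n g w s) := by
  have hM : (0 : ℝ) ≤ c / Real.sqrt (1 - c ^ 2) := by positivity
  refine exists_causal_extension (T := fun u r => clampedSlope c (forcedFlux n g u r))
    (M := ⟨_, hM⟩) (fun u r => abs_clampedSlope_le hc hc1 _)
    (fun u hu => (continuous_clampedSlope hc hc1).comp (continuous_forcedFlux hg hu))
    (fun u w r hr h => by rw [forcedFlux_congr hr h])
    (fun K U w a hU h0 hw _ r => ?_) hb hu₀ heq
  exact ((continuous_clampedSlope hc hc1).tendsto _).comp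
    ((tendsto_radialAverage hg hU h0 hw r).const_mul r).neg

/-! ### Intervals of existence and identities satisfied by solutions. -/

lemma interval_coe (b : ℝ) : interval (b : EReal) = Ico 0 b := by
  ext r
  simp [interval]

lemma interval_top : interval ⊤ = Ici 0 := by
  ext r
  simp [interval]

lemma interval_mono {R R' : EReal} (h : R ≤ R') : interval R ⊆ interval R' :=
  fun _ hr => ⟨hr.1, hr.2.trans_le h⟩

lemma zero_mem_interval {R : EReal} (h : 0 < R) : (0 : ℝ) ∈ interval R := ⟨le_rfl, by simpa using h⟩

lemma mem_interval_of_le {R : EReal} {r s : ℝ} (hr : r ∈ interval R) (h0 : 0 ≤ s) (hs : s ≤ r) :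
    s ∈ interval R :=
  ⟨h0, (EReal.coe_le_coe_iff.2 hs).trans_lt hr.2⟩

lemma Icc_subset_interval {R : EReal} {r : ℝ} (hr : r ∈ interval R) : Icc 0 r ⊆ interval R :=
  fun _ hs => mem_interval_of_le hr hs.1 hs.2

lemma eventually_lt_of_mem_interval {R : EReal} {r : ℝ} (hr : r ∈ interval R) :
    ∀ᶠ x : ℝ in 𝓝 r, (x : EReal) < R :=
  (isOpen_Iio.preimage continuous_coe_real_ereal).mem_nhds hr.2

lemma interval_mem_nhds {R : EReal} {r : ℝ} (hr : r ∈ interval R) (h0 : 0 < r) :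
    interval R ∈ 𝓝 r := by
  filter_upwards [eventually_lt_of_mem_interval hr, lt_mem_nhds h0] with x hx hx0
  exact ⟨hx0.le, hx⟩

lemma uniqueDiffOn_interval (R : EReal) : UniqueDiffOn ℝ (interval R) := by
  induction R with
  | bot =>
    have : interval ⊥ = ∅ := by ext r; simp [interval]
    rw [this]
    exact uniqueDiffOn_empty
  | coe b => rw [interval_coe]; exact uniqueDiffOn_Ico 0 b
  | top => rw [interval_top]; exact uniqueDiffOn_Ici 0

/-- Near a point of the smaller interval both intervals coincide, `0` included, so the derivatives
within them agree. -/
lemma prime_congr {R R' : EReal} {u v : ℝ → ℝ} (hR : R ≤ R') (h : EqOn u v (interval R)) :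
    EqOn (prime R u) (prime R' v) (interval R) := by
  intro r hr
  rw [prime, prime, derivWithin_congr h (h hr)]
  refine derivWithin_congr_set ?_
  filter_upwards [eventually_lt_of_mem_interval hr] with x hx
  exact propext ⟨fun hx' => interval_mono hR hx', fun hx' => ⟨hx'.1, hx⟩⟩

lemma flux_congr {R R' : EReal} {u v : ℝ → ℝ} (hR : R ≤ R') (h : EqOn u v (interval R)) :
    EqOn (flux R u) (flux R' v) (interval R) := by
  intro r hr
  rw [flux, flux, prime_congr hR h hr]

namespace IsSolution

variable {n : ℕ} {g : ℝ → ℝ} {ξ : ℝ} {R : EReal} {u : ℝ → ℝ}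

lemma hasDerivWithinAt (h : IsSolution (n + 1) g ξ R u) {r : ℝ} (hr : r ∈ interval R) :
    HasDerivWithinAt u (prime R u r) (interval R) r :=
  ((h.contDiffOn.differentiableOn two_ne_zero) r hr).hasDerivWithinAt

lemma continuousOn (h : IsSolution (n + 1) g ξ R u) : ContinuousOn u (interval R) :=
  h.contDiffOn.continuousOn

lemma hasDerivAt (h : IsSolution (n + 1) g ξ R u) {r : ℝ} (hr : r ∈ interval R) (h0 : 0 < r) :
    HasDerivAt u (prime R u r) r :=
  (h.hasDerivWithinAt hr).hasDerivAt (interval_mem_nhds hr h0)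

lemma contDiffOn_prime (h : IsSolution (n + 1) g ξ R u) :
    ContDiffOn ℝ 1 (prime R u) (interval R) :=
  ((contDiffOn_succ_iff_derivWithin (n := 1) (uniqueDiffOn_interval R)).1 h.contDiffOn).2.2

lemma contDiffOn_flux (h : IsSolution (n + 1) g ξ R u) :
    ContDiffOn ℝ 1 (flux R u) (interval R) := by
  have hp := h.contDiffOn_prime
  refine hp.div ((contDiffOn_const.add (hp.pow 2)).sqrt fun r _ => ?_) fun r _ => ?_
  · positivity
  · positivity

lemma hasDerivAt_flux (h : IsSolution (n + 1) g ξ R u) {r : ℝ} (hr : r ∈ interval R)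
    (h0 : 0 < r) : HasDerivAt (flux R u) (-(g (u r)) - n / r * flux R u r) r := by
  have hd := ((h.contDiffOn_flux.differentiableOn one_ne_zero) r hr).hasDerivWithinAt.hasDerivAt
    (interval_mem_nhds hr h0)
  refine hd.congr_deriv ?_
  have := h.equation r hr h0
  rw [prime] at this
  push_cast at this
  rw [add_sub_cancel_right] at this
  linarith

lemma flux_zero (h : IsSolution (n + 1) g ξ R u) : flux R u 0 = 0 := by
  rw [flux, h.initial_slope, zero_div]

lemma abs_flux_lt_one (r : ℝ) : |flux R u r| < 1 := RadialMeanCurvature.abs_flux_lt_one _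

lemma prime_eq (r : ℝ) : prime R u r = flux R u r / Real.sqrt (1 - flux R u r ^ 2) :=
  (slope_of_flux _).symm

/-- The integrating factor `rⁿ` puts the equation in divergence form. -/
lemma hasDerivAt_pow_mul_flux (h : IsSolution (n + 1) g ξ R u) {r : ℝ} (hr : r ∈ interval R)
    (h0 : 0 < r) : HasDerivAt (fun x => x ^ n * flux R u x) (-(r ^ n * g (u r))) r := by
  refine ((hasDerivAt_pow n r).mul (h.hasDerivAt_flux hr h0)).congr_deriv ?_
  rcases n with _ | n
  · simp
  · simp only [Nat.add_sub_cancel]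
    field_simp
    ring

lemma pow_mul_flux (h : IsSolution (n + 1) g ξ R u) (hg : Continuous g) (hn : n ≠ 0) {r : ℝ}
    (hr : r ∈ interval R) :
    r ^ n * flux R u r = -∫ s in (0 : ℝ)..r, s ^ n * g (u s) := by
  have hsub := Icc_subset_interval hr
  have h1 : ContinuousOn (fun s => s ^ n * g (u s)) (Icc 0 r) :=
    (continuousOn_pow n).mul (hg.comp_continuousOn (h.continuousOn.mono hsub))
  have h2 := intervalIntegral.integral_eq_sub_of_hasDerivAt_of_le hr.1
    (f := fun x => x ^ n * flux R u x) (f' := fun s => -(s ^ n * g (u s)))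
    ((continuousOn_pow n).mul (h.contDiffOn_flux.continuousOn.mono hsub))
    (fun s hs => h.hasDerivAt_pow_mul_flux (hsub ⟨hs.1.le, hs.2.le⟩) hs.1)
    (ContinuousOn.intervalIntegrable_of_Icc hr.1 h1.neg)
  rw [intervalIntegral.integral_neg] at h2
  simp only [zero_pow hn, zero_mul, sub_zero] at h2
  exact h2.symm

/-- The auxiliary `w` allows `u`, controlled only on the interval, to be replaced by a globally
continuous extension, for which `forcedFlux` is continuous up to the endpoint. -/
lemma flux_eq_forcedFlux (h : IsSolution (n + 1) g ξ R u) (hg : Continuous g) (hn : n ≠ 0)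
    {w : ℝ → ℝ} (hw : EqOn w u (interval R)) {r : ℝ} (hr : r ∈ interval R) :
    flux R u r = forcedFlux n g w r := by
  rcases hr.1.eq_or_lt with rfl | h0
  · rw [h.flux_zero, forcedFlux_zero]
  · refine mul_left_cancel₀ (pow_ne_zero n h0.ne') ?_
    rw [h.pow_mul_flux hg hn hr, pow_mul_forcedFlux, neg_inj]
    refine intervalIntegral.integral_congr fun s hs => ?_
    rw [uIcc_of_le hr.1] at hs
    simp only [hw (Icc_subset_interval hr hs)]

lemma restrict {R' : EReal} {v : ℝ → ℝ} (h : IsSolution (n + 1) g ξ R' v) (h0 : 0 < R)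
    (hR : R ≤ R') (huv : EqOn u v (interval R)) : IsSolution (n + 1) g ξ R u where
  endpoint_pos := h0
  contDiffOn := (h.contDiffOn.mono (interval_mono hR)).congr huv
  equation r hr hr0 := by
    rw [prime_congr hR (flux_congr hR huv) hr, flux_congr hR huv hr, huv hr]
    exact h.equation r (interval_mono hR hr) hr0
  initial_value := by rw [huv (zero_mem_interval h0), h.initial_value]
  initial_slope := by rw [prime_congr hR huv (zero_mem_interval h0), h.initial_slope]

end IsSolution

/-! ### From the integral equation to maximal solutions. -/

/-- A function is a solution on `[0, R)` if it is one near every point of `[0, R)`. -/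
lemma isSolution_of_forall_lt {n : ℕ} {g : ℝ → ℝ} {ξ : ℝ} {R : EReal} {u : ℝ → ℝ} (h0 : 0 < R)
    (h : ∀ r ∈ interval R, ∃ R' ≤ R, r ∈ interval R' ∧ IsSolution (n + 1) g ξ R' u) :
    IsSolution (n + 1) g ξ R u where
  endpoint_pos := h0
  contDiffOn r hr := by
    obtain ⟨R', hR', hr', h'⟩ := h r hr
    refine (h'.contDiffOn r hr').mono_of_mem_nhdsWithin ?_
    filter_upwards [self_mem_nhdsWithin,
      nhdsWithin_le_nhds (eventually_lt_of_mem_interval hr')] with x hx hx'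
    exact ⟨hx.1, hx'⟩
  equation r hr hr0 := by
    obtain ⟨R', hR', hr', h'⟩ := h r hr
    rw [← prime_congr hR' (flux_congr hR' fun _ _ => rfl) hr', ← flux_congr hR' (fun _ _ => rfl) hr']
    exact h'.equation r hr' hr0
  initial_value := by
    obtain ⟨R', hR', hr', h'⟩ := h 0 (zero_mem_interval h0)
    exact h'.initial_value
  initial_slope := by
    obtain ⟨R', hR', hr', h'⟩ := h 0 (zero_mem_interval h0)
    rw [← prime_congr hR' (fun _ _ => rfl) hr']
    exact h'.initial_slope

lemma contDiff_forcedFlux {n : ℕ} {g u : ℝ → ℝ} (hg : Continuous g) (hu : Continuous u) :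
    ContDiff ℝ 1 (forcedFlux n g u) := by
  refine contDiff_one_iff_deriv.2 ⟨fun r => (hasDerivAt_forcedFlux hg hu r).differentiableAt, ?_⟩
  have : deriv (forcedFlux n g u) = fun r => -(g (u r) - n * radialAverage n g u r) :=
    funext fun r => (hasDerivAt_forcedFlux hg hu r).deriv
  rw [this]
  have := continuous_radialAverage (n := n) hg hu
  fun_prop

/-- The regularity bootstraps: `forcedFlux` is `C¹` for merely continuous `w`, so the prescribed
slope is `C¹` and `w` is `C²`, also at `r = 0`. -/
lemma isSolution_of_forcedFlux {n : ℕ} {g : ℝ → ℝ} (hg : Continuous g) {R : EReal} (h0 : 0 < R)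
    {w : ℝ → ℝ} (hw : Continuous w) (hS : ∀ r ∈ interval R, |forcedFlux n g w r| < 1)
    (hd : ∀ r ∈ interval R, HasDerivWithinAt w
      (forcedFlux n g w r / Real.sqrt (1 - forcedFlux n g w r ^ 2)) (interval R) r) :
    IsSolution (n + 1) g (w 0) R w := by
  have hp : EqOn (prime R w) (fun r => forcedFlux n g w r /
      Real.sqrt (1 - forcedFlux n g w r ^ 2)) (interval R) := fun r hr =>
    (hd r hr).derivWithin (uniqueDiffOn_interval R r hr)
  have hf : EqOn (flux R w) (forcedFlux n g w) (interval R) := fun r hr => by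
    rw [flux, hp hr]
    exact slope_div_sqrt (hS r hr)
  have hpos : ∀ r ∈ interval R, 0 < 1 - forcedFlux n g w r ^ 2 := fun r hr => by
    have := (sq_lt_one_iff_abs_lt_one _).2 (hS r hr)
    linarith
  refine ⟨h0, ?_, fun r hr hr0 => ?_, rfl, ?_⟩
  · refine (contDiffOn_succ_iff_derivWithin (n := 1) (uniqueDiffOn_interval R)).2
      ⟨fun r hr => (hd r hr).differentiableWithinAt, by simp, ?_⟩
    have hc := (contDiff_forcedFlux (n := n) hg hw).contDiffOn (s := interval R)
    refine ContDiffOn.congr (hc.div ((contDiffOn_const.sub (hc.pow 2)).sqrt fun r hr => ?_)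
      fun r hr => ?_) hp
    · exact (hpos r hr).ne'
    · exact (Real.sqrt_pos.2 (hpos r hr)).ne'
  · have h1 : prime R (flux R w) r = -(g (w r) - n * radialAverage n g w r) := by
      rw [prime, derivWithin_congr hf (hf hr)]
      exact (hasDerivAt_forcedFlux hg hw r).hasDerivWithinAt.derivWithin
        (uniqueDiffOn_interval R r hr)
    rw [h1, hf hr, forcedFlux]
    push_cast
    field_simp
    ring
  · rw [hp (zero_mem_interval h0)]
    simp

/-- A solution of the integral equation on `[0, b]` continues past `b`. -/
theorem exists_solution_past {n : ℕ} {g : ℝ → ℝ} (hg : Continuous g) {b : ℝ} (hb : 0 ≤ b)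
    {u₀ : ℝ → ℝ} (hu₀ : Continuous u₀) (hS : ∀ r ∈ Icc 0 b, |forcedFlux n g u₀ r| < 1)
    (heq : ∀ r ∈ Icc 0 b, u₀ r = u₀ 0 + ∫ s in (0 : ℝ)..r,
      forcedFlux n g u₀ s / Real.sqrt (1 - forcedFlux n g u₀ s ^ 2)) :
    ∃ (b' : ℝ) (w : ℝ → ℝ), b < b' ∧ EqOn w u₀ (Icc 0 b) ∧
      IsSolution (n + 1) g (u₀ 0) b' w := by
  -- The strict gap below `c` leaves the truncation inactive on `[0, b]` and, by continuity,
  -- slightly beyond `b`.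
  obtain ⟨c, hc0, hc1, hc⟩ : ∃ c, 0 ≤ c ∧ c < 1 ∧ ∀ r ∈ Icc 0 b, |forcedFlux n g u₀ r| < c := by
    obtain ⟨x, hx, hmax⟩ := isCompact_Icc.exists_isMaxOn (nonempty_Icc.2 hb)
      (continuous_forcedFlux (n := n) hg hu₀).abs.continuousOn
    obtain ⟨c, h1, h2⟩ := exists_between (hS x hx)
    exact ⟨c, (abs_nonneg _).trans h1.le, h2, fun r hr => (hmax hr).trans_lt h1⟩
  obtain ⟨w, hw, hwu, hw_eq⟩ := exists_clamped_extension hg hc0 hc1 hb hu₀ fun r hr => by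
    rw [heq r hr]
    congr 1
    refine intervalIntegral.integral_congr fun s hs => ?_
    rw [uIcc_of_le hr.1] at hs
    exact (clampedSlope_of_abs_le (hc s ⟨hs.1, hs.2.trans hr.2⟩).le).symm
  have hSw : ∀ r ∈ Icc 0 b, |forcedFlux n g w r| < c := fun r hr => by
    rw [forcedFlux_congr hr.1 (hwu.mono (Icc_subset_Icc_right hr.2))]
    exact hc r hr
  have hSc := continuous_forcedFlux (n := n) hg hw
  have hev : ∀ᶠ r in 𝓝 b, |forcedFlux n g w r| < c :=
    hSc.abs.continuousAt.eventually_lt continuousAt_const (hSw b ⟨hb, le_rfl⟩)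
  obtain ⟨ε, hε, hball⟩ := Metric.eventually_nhds_iff.1 hev
  have hb' : b < b + min ε 1 := by linarith [lt_min hε one_pos]
  have hlt : ∀ r ∈ Ico 0 (b + min ε 1), |forcedFlux n g w r| < c := by
    intro r hr
    rcases le_or_gt r b with h | h
    · exact hSw r ⟨hr.1, h⟩
    · refine hball ?_
      rw [Real.dist_eq, abs_of_pos (by linarith)]
      linarith [hr.2, min_le_left ε 1]
  have hw0 : w 0 = u₀ 0 := hwu ⟨le_rfl, hb⟩
  refine ⟨b + min ε 1, w, hb', hwu, ?_⟩
  rw [← hw0]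
  refine isSolution_of_forcedFlux hg (by exact_mod_cast hb.trans_lt hb') hw ?_ ?_
  · intro r hr
    rw [interval_coe] at hr
    exact (hlt r hr).trans hc1
  · intro r hr
    rw [interval_coe] at hr ⊢
    have hcont : Continuous fun s => clampedSlope c (forcedFlux n g w s) :=
      (continuous_clampedSlope hc0 hc1).comp hSc
    have hI : HasDerivAt (fun x => u₀ 0 + ∫ s in (0 : ℝ)..x, clampedSlope c (forcedFlux n g w s))
        (clampedSlope c (forcedFlux n g w r)) r :=
      (intervalIntegral.integral_hasDerivAt_right (hcont.intervalIntegrable _ _)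
        (hcont.stronglyMeasurableAtFilter _ _) hcont.continuousAt).const_add _
    rw [← clampedSlope_of_abs_le (hlt r hr).le]
    have heq' : ∀ x ∈ Ico 0 (b + min ε 1),
        w x = u₀ 0 + ∫ s in (0 : ℝ)..x, clampedSlope c (forcedFlux n g w s) := fun x hx =>
      hw_eq x ⟨hx.1, hx.2.le.trans (by linarith [min_le_right ε 1])⟩
    exact hI.hasDerivWithinAt.congr heq' (heq' r hr)

/-- A maximal solution cannot be continued: at a finite endpoint the flux of every continuous
continuation is saturated. -/
lemma IsMaximalSolution.one_le_abs_forcedFlux {n : ℕ} {g : ℝ → ℝ} {ξ b : ℝ} {u w : ℝ → ℝ}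
    (hg : Continuous g) (hn : n ≠ 0) (h : IsMaximalSolution (n + 1) g ξ b u) (hw : Continuous w)
    (hwu : EqOn w u (Ico 0 b)) : 1 ≤ |forcedFlux n g w b| := by
  by_contra! hlt
  obtain ⟨hsol, hmax⟩ := h
  have hb : 0 < b := by exact_mod_cast hsol.endpoint_pos
  have hwu' : EqOn w u (interval b) := by rwa [interval_coe]
  have hw0 : w 0 = ξ := by rw [hwu ⟨le_rfl, hb⟩, hsol.initial_value]
  have hS : ∀ r ∈ Icc 0 b, |forcedFlux n g w r| < 1 := by
    intro r hr
    rcases hr.2.eq_or_lt with rfl | hrb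
    · exact hlt
    · have hr' : r ∈ interval b := by rw [interval_coe]; exact ⟨hr.1, hrb⟩
      rw [← hsol.flux_eq_forcedFlux hg hn hwu' hr']
      exact IsSolution.abs_flux_lt_one r
  have hSc : ContinuousOn (fun s => forcedFlux n g w s /
      Real.sqrt (1 - forcedFlux n g w s ^ 2)) (Icc 0 b) := by
    have hc := (continuous_forcedFlux (n := n) hg hw).continuousOn (s := Icc 0 b)
    refine hc.div (continuousOn_const.sub (hc.pow 2)).sqrt fun r hr => ?_
    have := (sq_lt_one_iff_abs_lt_one _).2 (hS r hr)
    exact (Real.sqrt_pos.2 (by linarith)).ne'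
  -- The integral equation on `[0, b]`, endpoint included, is the fundamental theorem of calculus
  -- for `w`, whose derivative is only needed in the open interval.
  obtain ⟨b', v, hbb', hv, hvs⟩ := exists_solution_past hg hb.le hw hS fun r hr => by
    have := intervalIntegral.integral_eq_sub_of_hasDerivAt_of_le hr.1 (f := w)
      hw.continuousOn (fun s hs => ?_)
      ((hSc.mono (Icc_subset_Icc_right hr.2)).intervalIntegrable_of_Icc hr.1)
    · rw [this]
      ring
    · have hsb : s < b := hs.2.trans_le hr.2
      have hs' : s ∈ interval b := by rw [interval_coe]; exact ⟨hs.1.le, hsb⟩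
      rw [← hsol.flux_eq_forcedFlux hg hn hwu' hs', ← IsSolution.prime_eq]
      refine (hsol.hasDerivAt hs' hs.1).congr_of_eventuallyEq ?_
      filter_upwards [interval_mem_nhds hs' hs.1] with x hx using hwu' hx
  rw [hw0] at hvs
  refine hmax b' v (by exact_mod_cast hbb') hvs fun r hr => ?_
  rw [interval_coe] at hr
  rw [hv ⟨hr.1, hr.2.le⟩, hwu hr]

/-- Existence of a maximal solution. -/
theorem exists_isMaximalSolution (n : ℕ) {g : ℝ → ℝ} (hg : Continuous g) (ξ : ℝ) :
    ∃ (R : EReal) (u : ℝ → ℝ), IsMaximalSolution (n + 1) g ξ R u := by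
  classical
  let X := {p : EReal × (ℝ → ℝ) // IsSolution (n + 1) g ξ p.1 p.2}
  -- Zorn's lemma for the order by extension; the members of a chain glue to a single function.
  let rel : X → X → Prop := fun p q => p.1.1 ≤ q.1.1 ∧ EqOn q.1.2 p.1.2 (interval p.1.1)
  have hbase : Nonempty X := by
    obtain ⟨b', w, hb', -, hs⟩ := exists_solution_past (n := n) (b := 0) (u₀ := fun _ => ξ) hg le_rfl
      continuous_const (fun r hr => by
        obtain rfl : r = 0 := le_antisymm hr.2 hr.1
        simp) (fun r hr => by
        obtain rfl : r = 0 := le_antisymm hr.2 hr.1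
        simp)
    exact ⟨⟨(b', w), hs⟩⟩
  obtain ⟨⟨⟨R, u⟩, hu⟩, hmax⟩ := exists_maximal_of_chains_bounded (r := rel) (fun c hc => by
    rcases c.eq_empty_or_nonempty with rfl | ⟨p₀, hp₀⟩
    · exact ⟨hbase.some, by simp⟩
    let R : EReal := sSup ((fun p : X => p.1.1) '' c)
    have hR : ∀ p ∈ c, p.1.1 ≤ R := fun p hp => le_sSup (mem_image_of_mem _ hp)
    let u : ℝ → ℝ := fun r =>
      if h : ∃ p ∈ c, r ∈ interval p.1.1 then h.choose.1.2 r else 0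
    have hu : ∀ p ∈ c, EqOn u p.1.2 (interval p.1.1) := by
      intro p hp r hr
      have hex : ∃ p ∈ c, r ∈ interval p.1.1 := ⟨p, hp, hr⟩
      have hur : u r = hex.choose.1.2 r := dif_pos hex
      obtain ⟨hq, hqr⟩ := hex.choose_spec
      rw [hur]
      rcases eq_or_ne hex.choose p with h | h
      · rw [h]
      · rcases hc hq hp h with h | h
        · exact (h.2 hqr).symm
        · exact h.2 hr
    have hs : ∀ p ∈ c, IsSolution (n + 1) g ξ p.1.1 u := fun p hp =>
      p.2.restrict p.2.endpoint_pos le_rfl (hu p hp)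
    refine ⟨⟨(R, u), isSolution_of_forall_lt (p₀.2.endpoint_pos.trans_le (hR p₀ hp₀)) ?_⟩,
      fun p hp => ⟨hR p hp, hu p hp⟩⟩
    intro r hr
    obtain ⟨_, ⟨p, hp, rfl⟩, hlt⟩ := lt_sSup_iff.1 hr.2
    exact ⟨p.1.1, hR p hp, ⟨hr.1, hlt⟩, hs p hp⟩)
    (fun {p q s} hpq hqs => ⟨hpq.1.trans hqs.1, fun r hr => by
      rw [hqs.2 (interval_mono hpq.1 hr), hpq.2 hr]⟩)
  exact ⟨R, u, hu, fun R' v hR hv heq => (hmax ⟨(R', v), hv⟩ ⟨hR.le, heq⟩).1.not_gt hR⟩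

/-! ### Initial values beyond `α`: growth and blow-up. -/

lemma exists_continuous_extension {b : ℝ} (hb : 0 < b) {u : ℝ → ℝ}
    (hu : ContinuousOn u (Ico 0 b)) (hlim : ∃ l, Tendsto u (𝓝[<] b) (𝓝 l)) :
    ∃ w : ℝ → ℝ, Continuous w ∧ EqOn w u (Ico 0 b) := by
  have hcl : closure (Ico 0 b) = Icc 0 b := closure_Ico hb.ne
  have hc : ContinuousOn (extendFrom (Ico 0 b) u) (Icc 0 b) := by
    refine continuousOn_extendFrom hcl.ge fun x hx => ?_
    rcases hx.2.eq_or_lt with rfl | hxb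
    · rwa [nhdsWithin_Ico_eq_nhdsLT hb]
    · exact ⟨_, hu x ⟨hx.1, hxb⟩⟩
  refine ⟨fun r => extendFrom (Ico 0 b) u (max 0 (min r b)),
    hc.comp_continuous (by fun_prop) fun r => ⟨le_max_left _ _, max_le hb.le (min_le_right _ _)⟩,
    fun r hr => ?_⟩
  simp only [min_eq_left hr.2.le, max_eq_right hr.1]
  exact extendFrom_eq (subset_closure hr) (hu r hr)

lemma eventually_leftLimit {R : EReal} {r : ℝ} (hr : (r : EReal) < R) :
    ∀ᶠ x in leftLimit R, r < x ∧ (x : EReal) < R := by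
  have h : Ioo (r : EReal) R ∈ 𝓝[<] R := Ioo_mem_nhdsLT hr
  filter_upwards [preimage_mem_comap h] with x hx
  exact ⟨EReal.coe_lt_coe_iff.1 hx.1, hx.2⟩

lemma leftLimit_coe_le (b : ℝ) : leftLimit b ≤ 𝓝 b := by
  rw [EReal.isEmbedding_coe.nhds_eq_comap]
  exact comap_mono nhdsWithin_le_nhds

lemma convex_interval (R : EReal) : Convex ℝ (interval R) :=
  OrdConnected.convex ⟨fun _ hx _ hy _ hz => mem_interval_of_le hy (hx.1.trans hz.1) hz.2⟩

lemma pos_of_mem_interior_interval {R : EReal} {r : ℝ} (hr : r ∈ interior (interval R)) :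
    0 < r := by
  have h : interior (interval R) ⊆ interior (Ici 0) := interior_mono fun _ hx => hx.1
  rw [interior_Ici] at h
  exact h hr

lemma flux_pos_iff {R : EReal} {u : ℝ → ℝ} {r : ℝ} : 0 < flux R u r ↔ 0 < prime R u r :=
  div_pos_iff_of_pos_right (Real.sqrt_pos.2 (by positivity))

namespace IsSolution

variable {n : ℕ} {g : ℝ → ℝ} {ξ : ℝ} {R : EReal} {u : ℝ → ℝ}

lemma continuousOn_pow_mul (h : IsSolution (n + 1) g ξ R u) (hg : Continuous g) {r : ℝ}
    (hr : r ∈ interval R) : ContinuousOn (fun s => s ^ n * g (u s)) (Icc 0 r) :=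
  (continuousOn_pow n).mul (hg.comp_continuousOn (h.continuousOn.mono (Icc_subset_interval hr)))

lemma flux_pos (h : IsSolution (n + 1) g ξ R u) (hg : Continuous g) (hn : n ≠ 0) {r : ℝ}
    (hr : r ∈ interval R) (h0 : 0 < r) (hneg : ∀ s ∈ Ioo 0 r, g (u s) < 0) :
    0 < flux R u r := by
  have h1 := intervalIntegral.intervalIntegral_pos_of_pos_on (f := fun s => -(s ^ n * g (u s)))
    ((h.continuousOn_pow_mul hg hr).neg.intervalIntegrable_of_Icc hr.1)
    (fun s hs => neg_pos.2 (mul_neg_of_pos_of_neg (pow_pos hs.1 n) (hneg s hs))) h0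
  rw [intervalIntegral.integral_neg, ← h.pow_mul_flux hg hn hr] at h1
  exact pos_of_mul_pos_right h1 (pow_nonneg h0.le n)

lemma flux_neg (h : IsSolution (n + 1) g ξ R u) (hg : Continuous g) (hn : n ≠ 0) {r : ℝ}
    (hr : r ∈ interval R) (h0 : 0 < r) (hpos : ∀ s ∈ Ioo 0 r, 0 < g (u s)) :
    flux R u r < 0 := by
  have h1 := intervalIntegral.intervalIntegral_pos_of_pos_on (f := fun s => s ^ n * g (u s))
    ((h.continuousOn_pow_mul hg hr).intervalIntegrable_of_Icc hr.1)
    (fun s hs => mul_pos (pow_pos hs.1 n) (hpos s hs)) h0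
  rw [← neg_neg (∫ s in (0 : ℝ)..r, s ^ n * g (u s)), ← h.pow_mul_flux hg hn hr, ← mul_neg] at h1
  exact neg_pos.1 (pos_of_mul_pos_right h1 (pow_nonneg h0.le n))

lemma strictMonoOn_of_prime_pos (h : IsSolution (n + 1) g ξ R u) {s : Set ℝ} (hs : Convex ℝ s)
    (hsub : s ⊆ interval R) (hp : ∀ r ∈ s, 0 < r → 0 < prime R u r) : StrictMonoOn u s := by
  refine strictMonoOn_of_deriv_pos hs (h.continuousOn.mono hsub) fun r hr => ?_
  have h0 := pos_of_mem_interior_interval (interior_mono hsub hr)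
  have hrs := interior_subset hr
  rw [(h.hasDerivAt (hsub hrs) h0).deriv]
  exact hp r hrs h0

/-- A solution starting in the region `g < 0` on the right stays in it. -/
lemma lt_of_neg (h : IsSolution (n + 1) g ξ R u) (hg : Continuous g) (hn : n ≠ 0) {a : ℝ}
    (ha : a < ξ) (hneg : ∀ t, a ≤ t → g t < 0) {r : ℝ} (hr : r ∈ interval R) : a < u r := by
  by_contra! hle
  have hsub := Icc_subset_interval hr
  have hclosed : IsClosed (Icc 0 r ∩ u ⁻¹' Iic a) :=
    (h.continuousOn.mono hsub).preimage_isClosed_of_isClosed isClosed_Icc isClosed_Iic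
  -- At the first radius `x` with `u x ≤ a`, the function has been increasing from `ξ > a`, since `g
  -- (u) < 0` before `x`.
  obtain ⟨x, ⟨hx, hxa⟩, hmin⟩ := (isCompact_Icc.of_isClosed_subset hclosed
    inter_subset_left).exists_isLeast ⟨r, ⟨hr.1, le_rfl⟩, hle⟩
  have hlt : ∀ s ∈ Ico 0 x, a < u s := by
    intro s hs
    by_contra! hsa
    exact (hmin ⟨⟨hs.1, hs.2.le.trans hx.2⟩, hsa⟩).not_gt hs.2
  have hmono := h.strictMonoOn_of_prime_pos (convex_Icc 0 x) ((Icc_subset_Icc_right hx.2).trans hsub)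
    fun s hs h0 => flux_pos_iff.1 <| h.flux_pos hg hn (hsub ⟨hs.1, hs.2.trans hx.2⟩) h0
      fun y hy => hneg _ (hlt y ⟨hy.1.le, hy.2.trans_le hs.2⟩).le
  have h0x := hmono.monotoneOn ⟨le_rfl, hx.1⟩ ⟨hx.1, le_rfl⟩ hx.1
  rw [h.initial_value] at h0x
  exact (ha.trans_le (h0x.trans hxa)).false

/-- A bounded solution in the region `g < 0` lives on a bounded interval. -/
lemma false_of_bounded_of_neg (h : IsSolution (n + 1) g ξ ⊤ u) (hg : Continuous g) (hn : n ≠ 0)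
    {a B : ℝ} (hlow : ∀ r, 0 ≤ r → a ≤ u r) (hup : ∀ r, 0 ≤ r → u r ≤ B)
    (hneg : ∀ t, a ≤ t → g t < 0) : False := by
  have haB : a ≤ B := (hlow 0 le_rfl).trans (hup 0 le_rfl)
  obtain ⟨t, ht, hmax⟩ := isCompact_Icc.exists_isMaxOn (nonempty_Icc.2 haB)
    (hg.continuousOn (s := Icc a B))
  set m := -g t with hm
  have hm0 : 0 < m := neg_pos.2 (hneg t ht.1)
  -- With `g (u) ≤ -m`, the flux at `r` is at least `r * m / (n + 1)`; this radius makes the bound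
  -- equal to `1`.
  set r := ((n : ℝ) + 1) / m with hr
  have hr0 : 0 < r := by positivity
  have hrI : r ∈ interval ⊤ := by rw [interval_top]; exact hr0.le
  have hle : ∫ s in (0 : ℝ)..r, s ^ n * g (u s) ≤ ∫ s in (0 : ℝ)..r, s ^ n * (-m) := by
    refine intervalIntegral.integral_mono_on hr0.le
      ((h.continuousOn_pow_mul hg hrI).intervalIntegrable_of_Icc hr0.le)
      ((by fun_prop : Continuous fun s : ℝ => s ^ n * (-m)).intervalIntegrable _ _) fun s hs => ?_
    refine mul_le_mul_of_nonneg_left ?_ (pow_nonneg hs.1 n)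
    rw [hm, neg_neg]
    exact hmax ⟨hlow s hs.1, hup s hs.1⟩
  rw [intervalIntegral.integral_mul_const, integral_pow, zero_pow (Nat.succ_ne_zero n), sub_zero]
    at hle
  have hflux := h.pow_mul_flux hg hn hrI
  have h1 : r ^ n * 1 ≤ r ^ n * flux ⊤ u r := by
    have : r ^ (n + 1) / ((n : ℝ) + 1) * -m = -(r ^ n * 1) := by
      rw [pow_succ, hr]
      field_simp
    linarith
  have h2 := le_of_mul_le_mul_left h1 (pow_pos hr0 n)
  exact ((abs_lt.1 (abs_flux_lt_one (R := ⊤) (u := u) r)).2).not_ge h2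

end IsSolution

/-- Solutions starting in the region `g < 0` increase up to blow-up. -/
theorem IsMaximalSolution.blow_up {n : ℕ} {g : ℝ → ℝ} {ξ : ℝ} {R : EReal} {u : ℝ → ℝ}
    (h : IsMaximalSolution (n + 1) g ξ R u) (hg : Continuous g) (hn : n ≠ 0) {a : ℝ}
    (ha0 : 0 ≤ a) (ha : a < ξ) (hneg : ∀ t, a ≤ t → g t < 0) :
    StrictMonoOn (fun r => |u r|) (interval R) ∧
      (Tendsto (fun r => |u r|) (leftLimit R) atTop ∨
        Tendsto (fun r => |prime R u r|) (leftLimit R) atTop) := by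
  have hsol := h.1
  have hlow : ∀ r ∈ interval R, a < u r := fun r hr => hsol.lt_of_neg hg hn ha hneg hr
  have hflux : ∀ r ∈ interval R, 0 < r → 0 < flux R u r := fun r hr h0 =>
    hsol.flux_pos hg hn hr h0 fun s hs =>
      hneg _ (hlow s (mem_interval_of_le hr hs.1.le hs.2.le)).le
  have hmono : StrictMonoOn u (interval R) :=
    hsol.strictMonoOn_of_prime_pos (convex_interval R) subset_rfl fun r hr h0 =>
      flux_pos_iff.1 (hflux r hr h0)
  have habs : ∀ r ∈ interval R, |u r| = u r := fun r hr =>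
    abs_of_nonneg (ha0.trans (hlow r hr).le)
  refine ⟨hmono.congr fun r hr => (habs r hr).symm, ?_⟩
  by_cases hB : ∃ B, ∀ r ∈ interval R, u r ≤ B
  · right
    obtain ⟨B, hB⟩ := hB
    induction R with
    | bot => exact absurd hsol.endpoint_pos (by simp)
    | top =>
      rw [interval_top] at hlow hB
      exact (hsol.false_of_bounded_of_neg hg hn (fun r hr => (hlow r hr).le) hB hneg).elim
    | coe b =>
      have hb : 0 < b := by exact_mod_cast hsol.endpoint_pos
      have hI := interval_coe b
      have hlim : Tendsto u (𝓝[<] b) (𝓝 (sSup (u '' Ioo 0 b))) := by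
        refine MonotoneOn.tendsto_nhdsWithin_Ioo_left (nonempty_Ioo.2 hb) ?_ ⟨B, ?_⟩
        · rw [hI] at hmono
          exact hmono.monotoneOn.mono Ioo_subset_Ico_self
        · rintro _ ⟨r, hr, rfl⟩
          exact hB r (by rw [hI]; exact ⟨hr.1.le, hr.2⟩)
      obtain ⟨w, hw, hwu⟩ := exists_continuous_extension hb (hI ▸ hsol.continuousOn) ⟨_, hlim⟩
      have hfl : ∀ r ∈ interval b, flux b u r = forcedFlux n g w r := fun r hr =>
        hsol.flux_eq_forcedFlux hg hn (hI ▸ hwu) hr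
      have hSc := continuous_forcedFlux (n := n) hg hw
      have hnonneg : 0 ≤ forcedFlux n g w b := by
        refine ge_of_tendsto (hSc.continuousWithinAt (s := Iio b)).tendsto ?_
        filter_upwards [Ioo_mem_nhdsLT hb] with r hr
        have hr' : r ∈ interval b := by rw [hI]; exact ⟨hr.1.le, hr.2⟩
        rw [← hfl r hr']
        exact (hflux r hr' hr.1).le
      have hone := h.one_le_abs_forcedFlux hg hn hw hwu
      rw [abs_of_nonneg hnonneg] at hone
      refine tendsto_atTop.2 fun K => ?_
      -- A saturated flux exceeds the flux of every slope `K`, so near `b` monotonicity of the flux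
      -- map gives `u' > K`.
      have hK : K / Real.sqrt (1 + K ^ 2) < forcedFlux n g w b :=
        (abs_lt.1 (abs_flux_lt_one K)).2.trans_le hone
      have hev := leftLimit_coe_le b (hSc.continuousAt.eventually (lt_mem_nhds hK))
      filter_upwards [hev, eventually_leftLimit hsol.endpoint_pos] with r hr hr0
      have hr' : r ∈ interval b := ⟨hr0.1.le, hr0.2⟩
      rw [← hfl r hr', flux] at hr
      exact (strictMono_flux.lt_iff_lt.1 hr).le.trans (le_abs_self _)
  · left
    push Not at hB
    refine tendsto_atTop.2 fun K => ?_
    obtain ⟨r₀, hr₀, hK⟩ := hB K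
    filter_upwards [eventually_leftLimit hr₀.2] with r hr
    have hr' : r ∈ interval R := ⟨hr₀.1.trans hr.1.le, hr.2⟩
    exact hK.le.trans ((hmono hr₀ hr' hr.1).le.trans (le_abs_self _))

/-! ### Potential, energy and global existence. -/

/-- The primitive `G(t) = ∫₀ᵗ g`. -/
noncomputable def potential (g : ℝ → ℝ) (t : ℝ) : ℝ := ∫ s in (0 : ℝ)..t, g s

lemma hasDerivAt_potential {g : ℝ → ℝ} (hg : Continuous g) (t : ℝ) :
    HasDerivAt (potential g) (g t) t :=
  intervalIntegral.integral_hasDerivAt_right (hg.intervalIntegrable _ _)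
    (hg.stronglyMeasurableAtFilter _ _) hg.continuousAt

lemma continuous_potential {g : ℝ → ℝ} (hg : Continuous g) : Continuous (potential g) :=
  continuous_iff_continuousAt.2 fun t => (hasDerivAt_potential hg t).continuousAt

lemma potential_neg {g : ℝ → ℝ} (hodd : ∀ t, g (-t) = -g t) (t : ℝ) :
    potential g (-t) = potential g t := by
  have h := intervalIntegral.integral_comp_neg (a := 0) (b := t) g
  simp only [hodd, neg_zero, intervalIntegral.integral_neg] at h
  rw [potential, potential, intervalIntegral.integral_symm, ← h, neg_neg]

lemma potential_abs {g : ℝ → ℝ} (hodd : ∀ t, g (-t) = -g t) (t : ℝ) :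
    potential g |t| = potential g t := by
  rcases abs_choice t with h | h <;> rw [h]
  exact potential_neg hodd t

lemma potential_strictMonoOn {g : ℝ → ℝ} (hg : Continuous g) {β : ℝ}
    (hpos : ∀ t, 0 < t → t ≤ β → 0 < g t) : StrictMonoOn (potential g) (Icc 0 β) := by
  refine strictMonoOn_of_deriv_pos (convex_Icc 0 β) (continuous_potential hg).continuousOn
    fun t ht => ?_
  rw [interior_Icc] at ht
  rw [(hasDerivAt_potential hg t).deriv]
  exact hpos t ht.1 ht.2.le

/-- Linear upper and lower bounds for an odd function with positive slope at the origin. -/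
lemma exists_linear_bounds {g : ℝ → ℝ} (hg : Continuous g) (hodd : ∀ t, g (-t) = -g t)
    (hdiff : DifferentiableAt ℝ g 0) (hderiv : 0 < deriv g 0) {β : ℝ} (hβ : 0 ≤ β)
    (hpos : ∀ t, 0 < t → t ≤ β → 0 < g t) :
    ∃ k K : ℝ, 0 < k ∧ 0 < K ∧ (∀ t, 0 ≤ t → t ≤ β → k * t ≤ g t ∧ g t ≤ K * t) := by
  have hg0 : g 0 = 0 := by
    have := hodd 0
    rw [neg_zero] at this
    linarith
  -- `dslope` extends `g t / t` continuously by `g'(0) > 0` at `0`; the two constants are its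
  -- minimum and maximum on `[0, β]`.
  have hc : ContinuousOn (dslope g 0) (Icc 0 β) := by
    intro t _
    rcases eq_or_ne t 0 with rfl | ht
    · exact (continuousAt_dslope_same.2 hdiff).continuousWithinAt
    · exact ((continuousAt_dslope_of_ne ht).2 hg.continuousAt).continuousWithinAt
  have hmul : ∀ t, g t = t * dslope g 0 t := fun t => by
    have := sub_smul_dslope g 0 t
    rw [hg0, sub_zero, sub_zero, smul_eq_mul] at this
    exact this.symm
  have hp : ∀ t ∈ Icc 0 β, 0 < dslope g 0 t := by
    intro t ht
    rcases ht.1.eq_or_lt with rfl | h0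
    · rwa [dslope_same]
    · have := hpos t h0 ht.2
      rw [hmul] at this
      exact pos_of_mul_pos_right this h0.le
  obtain ⟨x, hx, hmin⟩ := isCompact_Icc.exists_isMinOn (nonempty_Icc.2 hβ) hc
  obtain ⟨y, hy, hmax⟩ := isCompact_Icc.exists_isMaxOn (nonempty_Icc.2 hβ) hc
  refine ⟨dslope g 0 x, dslope g 0 y, hp x hx, hp y hy, fun t h0 h1 => ?_⟩
  rw [hmul t, mul_comm t]
  exact ⟨mul_le_mul_of_nonneg_right (hmin ⟨h0, h1⟩) h0,
    mul_le_mul_of_nonneg_right (hmax ⟨h0, h1⟩) h0⟩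

/-- Quadratic bounds for `t g(t)` and for the primitive of `g`. -/
lemma exists_quadratic_bounds {g : ℝ → ℝ} (hg : Continuous g) (hodd : ∀ t, g (-t) = -g t)
    (hdiff : DifferentiableAt ℝ g 0) (hderiv : 0 < deriv g 0) {β : ℝ} (hβ : 0 ≤ β)
    (hpos : ∀ t, 0 < t → t ≤ β → 0 < g t) :
    ∃ k B : ℝ, 0 < k ∧ 0 < B ∧ ∀ t, |t| ≤ β →
      k * t ^ 2 ≤ t * g t ∧ k / 2 * t ^ 2 ≤ potential g t ∧ potential g t ≤ B * (t * g t) := by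
  obtain ⟨k, K, hk, hK, hlin⟩ := exists_linear_bounds hg hodd hdiff hderiv hβ hpos
  have key : ∀ t, 0 ≤ t → t ≤ β → k * t ^ 2 ≤ t * g t ∧ k / 2 * t ^ 2 ≤ potential g t ∧
      potential g t ≤ K / (2 * k) * (t * g t) := by
    intro t h0 h1
    have hlow : k * t ^ 2 ≤ t * g t := by nlinarith [(hlin t h0 h1).1]
    have hI : ∀ c : ℝ, ∫ s in (0 : ℝ)..t, c * s = c / 2 * t ^ 2 := fun c => by
      rw [intervalIntegral.integral_const_mul, integral_id]
      ring
    have hi : ∀ c : ℝ, IntervalIntegrable (fun s => c * s) volume 0 t := fun c =>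
      (by fun_prop : Continuous fun s : ℝ => c * s).intervalIntegrable _ _
    have h2 : k / 2 * t ^ 2 ≤ potential g t := by
      rw [← hI]
      exact intervalIntegral.integral_mono_on h0 (hi k) (hg.intervalIntegrable _ _)
        fun s hs => (hlin s hs.1 (hs.2.trans h1)).1
    have h3 : potential g t ≤ K / 2 * t ^ 2 := by
      rw [← hI]
      exact intervalIntegral.integral_mono_on h0 (hg.intervalIntegrable _ _) (hi K)
        fun s hs => (hlin s hs.1 (hs.2.trans h1)).2
    refine ⟨hlow, h2, h3.trans ?_⟩
    calc K / 2 * t ^ 2 = K / (2 * k) * (k * t ^ 2) := by field_simp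
      _ ≤ K / (2 * k) * (t * g t) := by gcongr
  refine ⟨k, K / (2 * k), hk, by positivity, fun t ht => ?_⟩
  have h := key |t| (abs_nonneg t) ht
  rw [potential_abs hodd, sq_abs] at h
  have h4 : |t| * g |t| = t * g t := by
    rcases abs_choice t with h | h <;> rw [h]
    rw [hodd]
    ring
  rwa [h4] at h

/-- The energy `1 - 1/√(1+(u')²) + G(u)`, written in terms of the flux. -/
noncomputable def energy (g : ℝ → ℝ) (R : EReal) (u : ℝ → ℝ) (r : ℝ) : ℝ :=
  1 - Real.sqrt (1 - flux R u r ^ 2) + potential g (u r)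

namespace IsSolution

variable {n : ℕ} {g : ℝ → ℝ} {ξ : ℝ} {R : EReal} {u : ℝ → ℝ}

lemma one_sub_flux_sq_pos (r : ℝ) : 0 < 1 - flux R u r ^ 2 := by
  have := (sq_lt_one_iff_abs_lt_one _).2 (abs_flux_lt_one (R := R) (u := u) r)
  linarith

lemma flux_sq_le (r : ℝ) : flux R u r ^ 2 ≤ prime R u r * flux R u r := by
  have hs := Real.sqrt_pos.2 (one_sub_flux_sq_pos (R := R) (u := u) r)
  rw [prime_eq, div_mul_eq_mul_div, le_div_iff₀ hs, ← sq]
  refine mul_le_of_le_one_right (sq_nonneg _) (Real.sqrt_le_one.2 ?_)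
  nlinarith [sq_nonneg (flux R u r)]

lemma kinetic_le (r : ℝ) : 1 - Real.sqrt (1 - flux R u r ^ 2) ≤ flux R u r ^ 2 := by
  have h0 := one_sub_flux_sq_pos (R := R) (u := u) r
  have hs := Real.sqrt_nonneg (1 - flux R u r ^ 2)
  have h1 := Real.sq_sqrt h0.le
  have h2 : Real.sqrt (1 - flux R u r ^ 2) ≤ 1 :=
    Real.sqrt_le_one.2 (by nlinarith [sq_nonneg (flux R u r)])
  nlinarith

lemma le_kinetic (r : ℝ) : flux R u r ^ 2 / 2 ≤ 1 - Real.sqrt (1 - flux R u r ^ 2) := by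
  have h1 := Real.sq_sqrt (one_sub_flux_sq_pos (R := R) (u := u) r).le
  nlinarith [sq_nonneg (1 - Real.sqrt (1 - flux R u r ^ 2))]

lemma energy_zero (h : IsSolution (n + 1) g ξ R u) : energy g R u 0 = potential g ξ := by
  simp [energy, h.flux_zero, h.initial_value]

/-- Multiplying the equation by `u'` cancels the potential term against `g (u) u'`; only the
friction `(n/r) u' v` survives. -/
lemma hasDerivAt_energy (h : IsSolution (n + 1) g ξ R u) (hg : Continuous g) {r : ℝ}
    (hr : r ∈ interval R) (h0 : 0 < r) :
    HasDerivAt (energy g R u) (-(n / r * (prime R u r * flux R u r))) r := by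
  have hp := one_sub_flux_sq_pos (R := R) (u := u) r
  have h1 := ((((h.hasDerivAt_flux hr h0).pow 2).const_sub 1).sqrt hp.ne').const_sub 1
  have h2 := (hasDerivAt_potential hg (u r)).comp r (h.hasDerivAt hr h0)
  refine (h1.add h2).congr_deriv ?_
  have hs := Real.sqrt_pos.2 hp
  rw [prime_eq]
  simp only [Pi.pow_apply]
  field_simp
  ring

lemma continuousOn_energy (h : IsSolution (n + 1) g ξ R u) (hg : Continuous g) :
    ContinuousOn (energy g R u) (interval R) := by
  have hf := h.contDiffOn_flux.continuousOn
  exact (continuousOn_const.sub (continuousOn_const.sub (hf.pow 2)).sqrt).add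
    ((continuous_potential hg).comp_continuousOn h.continuousOn)

lemma antitoneOn_energy (h : IsSolution (n + 1) g ξ R u) (hg : Continuous g) :
    AntitoneOn (energy g R u) (interval R) := by
  refine antitoneOn_of_hasDerivWithinAt_nonpos (convex_interval R) (h.continuousOn_energy hg)
    (f' := fun r => -(n / r * (prime R u r * flux R u r))) (fun r hr => ?_) fun r hr => ?_
  · exact (h.hasDerivAt_energy hg (interior_subset hr)
      (pos_of_mem_interior_interval hr)).hasDerivWithinAt
  · have h0 := pos_of_mem_interior_interval hr
    have h1 := (sq_nonneg _).trans (flux_sq_le (R := R) (u := u) r)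
    have : 0 ≤ n / r * (prime R u r * flux R u r) := by positivity
    linarith

lemma energy_le (h : IsSolution (n + 1) g ξ R u) (hg : Continuous g) {r : ℝ}
    (hr : r ∈ interval R) : energy g R u r ≤ potential g ξ := by
  rw [← h.energy_zero]
  exact h.antitoneOn_energy hg (zero_mem_interval h.endpoint_pos) hr hr.1

lemma potential_le_energy (r : ℝ) : potential g (u r) ≤ energy g R u r := by
  have := (by positivity : 0 ≤ flux R u r ^ 2 / 2).trans (le_kinetic r)
  rw [energy]
  linarith

/-- If `|u|` exceeded `ξ`, it would take a value in `(ξ, β]`, where the strictly increasing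
potential is above `G(ξ)`, the upper bound of the energy. -/
lemma abs_le_initial_value (h : IsSolution (n + 1) g ξ R u) (hg : Continuous g) (hodd : ∀ t, g (-t) = -g t)
    (hξ : 0 < ξ) {β : ℝ} (hβ : ξ < β) (hpos : ∀ t, 0 < t → t ≤ β → 0 < g t) {r : ℝ}
    (hr : r ∈ interval R) : |u r| ≤ ξ := by
  by_contra! hlt
  have hc : ContinuousOn (fun s => |u s|) (Icc 0 r) :=
    (h.continuousOn.mono (Icc_subset_interval hr)).abs
  have hy : min β |u r| ∈ Icc |u 0| |u r| := by
    rw [h.initial_value, abs_of_pos hξ]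
    exact ⟨le_min hβ.le hlt.le, min_le_right _ _⟩
  obtain ⟨s, hs, hus⟩ := intermediate_value_Icc hr.1 hc hy
  have h1 : potential g (u s) ≤ potential g ξ :=
    (potential_le_energy (R := R) s).trans (h.energy_le hg (Icc_subset_interval hr hs))
  rw [← potential_abs hodd] at h1
  have h2 := potential_strictMonoOn hg hpos ⟨hξ.le, hβ.le⟩
    (show |u s| ∈ Icc 0 β from ⟨abs_nonneg _, hus.le.trans (min_le_left _ _)⟩)
    (by simp only [hus]; exact lt_min hβ hlt)
  exact h2.not_ge h1

/-- The energy drops at once when the initial value is not an equilibrium. -/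
lemma exists_energy_lt (h : IsSolution (n + 1) g ξ R u) (hg : Continuous g) (hn : n ≠ 0)
    (hpos : 0 < g ξ) : ∃ r ∈ interval R, 0 < r ∧ energy g R u r < potential g ξ := by
  have h0R := zero_mem_interval h.endpoint_pos
  have hev : ∀ᶠ s in 𝓝[interval R] 0, 0 < g (u s) := by
    have hc : ContinuousWithinAt (fun s => g (u s)) (interval R) 0 :=
      (hg.comp_continuousOn h.continuousOn) 0 h0R
    refine hc.eventually (lt_mem_nhds ?_)
    simpa only [h.initial_value] using hpos
  rw [eventually_nhdsWithin_iff] at hev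
  obtain ⟨δ, hδ, hball⟩ := Metric.eventually_nhds_iff.1
    (hev.and (eventually_lt_of_mem_interval h0R))
  have hδ' : ∀ s, 0 ≤ s → s ≤ δ / 2 → s ∈ interval R ∧ 0 < g (u s) := by
    intro s h1 h2
    have := hball (y := s) (by rw [Real.dist_0_eq_abs, abs_of_nonneg h1]; linarith)
    exact ⟨⟨h1, this.2⟩, this.1 ⟨h1, this.2⟩⟩
  have hsub : Icc 0 (δ / 2) ⊆ interval R := fun s hs => (hδ' s hs.1 hs.2).1
  have hanti : StrictAntiOn (energy g R u) (Icc 0 (δ / 2)) := by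
    refine strictAntiOn_of_deriv_neg (convex_Icc _ _) ((h.continuousOn_energy hg).mono hsub)
      fun s hs => ?_
    rw [interior_Icc] at hs
    have hsI := hsub ⟨hs.1.le, hs.2.le⟩
    rw [(h.hasDerivAt_energy hg hsI hs.1).deriv, neg_neg_iff_pos]
    have hfl := h.flux_neg hg hn hsI hs.1 fun y hy => (hδ' y hy.1.le (hy.2.trans hs.2).le).2
    have h1 := (sq_pos_of_neg hfl).trans_le (flux_sq_le s)
    have := hs.1
    have : (0 : ℝ) < n := by exact_mod_cast Nat.pos_of_ne_zero hn
    positivity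
  refine ⟨δ / 2, hsub ⟨by positivity, le_rfl⟩, by positivity, ?_⟩
  rw [← h.energy_zero]
  exact hanti ⟨le_rfl, by positivity⟩ ⟨by positivity, le_rfl⟩ (by positivity)

end IsSolution

/-- Solutions of small energy are global. -/
theorem IsMaximalSolution.endpoint_eq_top {n : ℕ} {g : ℝ → ℝ} {ξ : ℝ} {R : EReal} {u : ℝ → ℝ}
    (h : IsMaximalSolution (n + 1) g ξ R u) (hg : Continuous g) (hn : n ≠ 0) (hpos : 0 < g ξ)
    (hG : ∀ r ∈ interval R, 0 ≤ potential g (u r)) (hle : potential g ξ ≤ 1) : R = ⊤ := by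
  have hsol := h.1
  induction R with
  | bot => exact absurd hsol.endpoint_pos (by simp)
  | top => rfl
  | coe b =>
    exfalso
    have hI := interval_coe b
    obtain ⟨r₀, hr₀, hr₀0, hlt⟩ := hsol.exists_energy_lt hg hn hpos
    -- The strict drop `e < G(ξ) ≤ 1` covers the borderline `G(ξ) = 1`. Since `G(u) ≥ 0`, after `r₀`
    -- one has `√(1 - v²) ≥ 1 - e > 0`, which bounds `u'` and contradicts saturation at `b`.
    have hr₀b : r₀ < b := by rw [hI] at hr₀; exact hr₀.2
    set e := energy g b u r₀ with he
    have he1 : 0 < 1 - e := by linarith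
    have hsq : ∀ r ∈ interval b, r₀ ≤ r → 1 - e ≤ Real.sqrt (1 - flux b u r ^ 2) := by
      intro r hr hrr
      have h1 := hsol.antitoneOn_energy hg hr₀ hr hrr
      have h2 := hG r hr
      rw [energy] at h1
      linarith
    obtain ⟨C, hC⟩ := isCompact_Icc.exists_bound_of_continuousOn
      (hsol.contDiffOn_prime.continuousOn.mono (Icc_subset_interval hr₀))
    have hbound : ∀ r ∈ interval b, ‖prime b u r‖₊ ≤ (max C (1 / (1 - e))).toNNReal := by
      intro r hr
      rw [← NNReal.coe_le_coe, coe_nnnorm]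
      refine le_trans ?_ (Real.le_coe_toNNReal _)
      rcases le_total r r₀ with hrr | hrr
      · exact (hC r ⟨hr.1, hrr⟩).trans (le_max_left _ _)
      · refine le_trans ?_ (le_max_right _ _)
        rw [IsSolution.prime_eq, norm_div, Real.norm_eq_abs, Real.norm_of_nonneg (Real.sqrt_nonneg _)]
        exact div_le_div₀ zero_le_one (IsSolution.abs_flux_lt_one r).le he1 (hsq r hr hrr)
    have hlip : LipschitzOnWith (max C (1 / (1 - e))).toNNReal u (interval b) :=
      (convex_interval b).lipschitzOnWith_of_nnnorm_hasDerivWithin_le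
        (fun r hr => hsol.hasDerivWithinAt hr) hbound
    obtain ⟨w, hw, huw⟩ := hlip.extend_real
    have hb := h.one_le_abs_forcedFlux hg hn hw.continuous (hI ▸ huw.symm)
    have hSc := continuous_forcedFlux (n := n) hg hw.continuous
    have hlim : 1 - e ≤ Real.sqrt (1 - forcedFlux n g w b ^ 2) := by
      have hc : Continuous fun r => Real.sqrt (1 - forcedFlux n g w r ^ 2) := by fun_prop
      refine ge_of_tendsto (hc.continuousWithinAt (s := Iio b) (x := b)).tendsto ?_
      filter_upwards [Ioo_mem_nhdsLT hr₀b] with r hr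
      have hrI : r ∈ interval b := by rw [hI]; exact ⟨hr₀0.le.trans hr.1.le, hr.2⟩
      rw [← hsol.flux_eq_forcedFlux hg hn huw.symm hrI]
      exact hsq r hrI hr.1.le
    have := Real.sqrt_pos.1 (he1.trans_le hlim)
    have h1 : (1 : ℝ) ≤ forcedFlux n g w b ^ 2 := by
      rw [← sq_abs]
      exact one_le_pow₀ hb
    linarith

/-! ### Oscillation and decay of global solutions. -/

namespace IsSolution

variable {n : ℕ} {g : ℝ → ℝ} {ξ : ℝ} {u : ℝ → ℝ}

/-- Global solutions along which `u g(u) ≥ k u²` vanish arbitrarily far out: otherwise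
`arctan (-v / (√k u))`, with `v` the flux, would increase without bound. -/
lemma exists_zero_ge (h : IsSolution (n + 1) g ξ ⊤ u) {k : ℝ} (hk : 0 < k)
    (hgk : ∀ r, 0 ≤ r → k * u r ^ 2 ≤ u r * g (u r)) (A : ℝ) : ∃ r, A ≤ r ∧ 0 ≤ r ∧ u r = 0 := by
  by_contra! hne
  set κ := Real.sqrt k with hκ
  have hκ0 : 0 < κ := Real.sqrt_pos.2 hk
  have hκ2 : κ ^ 2 = k := Real.sq_sqrt hk.le
  -- Beyond `n / κ` the friction coefficient `n / r` is at most `κ`, so the cross term `(n/r) u v`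
  -- costs at most half of `k u² + v²`; the angle still turns at rate `κ / 2`.
  set a := max A (max 1 (n / κ)) with ha
  have ha1 : 1 ≤ a := (le_max_left _ _).trans (le_max_right _ _)
  have haA : A ≤ a := le_max_left _ _
  have han : n / κ ≤ a := (le_max_right _ _).trans (le_max_right _ _)
  set v := flux ⊤ u with hv
  set p := prime ⊤ u with hp
  have hI : ∀ r, 0 < r → r ∈ interval ⊤ := fun r hr => by rw [interval_top]; exact hr.le
  have hder : ∀ r, a ≤ r → ∃ d, κ / 2 ≤ d ∧
      HasDerivAt (fun x => Real.arctan (-v x / (κ * u x))) d r := by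
    intro r hr
    have hr0 : 0 < r := by linarith
    have hu0 : u r ≠ 0 := hne r (haA.trans hr) hr0.le
    have h1 := (h.hasDerivAt_flux (hI r hr0) hr0).neg
    have h2 := (h.hasDerivAt (hI r hr0) hr0).const_mul κ
    have h3 : HasDerivAt (fun x => Real.arctan (-v x / (κ * u x))) _ r :=
      (h1.div h2 (mul_ne_zero hκ0.ne' hu0)).arctan
    refine ⟨_, ?_, h3⟩
    simp only [Pi.neg_apply, Pi.div_apply]
    have hvp : v r ^ 2 ≤ p r * v r := flux_sq_le r
    have hgr := hgk r hr0.le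
    have hnr : n / r ≤ κ := by
      rw [div_le_iff₀ hr0]
      rw [div_le_iff₀ hκ0] at han
      nlinarith
    have hnr0 : 0 ≤ n / r := by positivity
    have hD : 0 < k * u r ^ 2 + v r ^ 2 := by positivity
    have hkey : (k * u r ^ 2 + v r ^ 2) / 2 ≤
        u r * g (u r) + n / r * (v r * u r) + p r * v r := by
      have hcross : -((k * u r ^ 2 + v r ^ 2) / 2) ≤ n / r * (v r * u r) := by
        have h5 : κ * |v r * u r| ≤ (k * u r ^ 2 + v r ^ 2) / 2 := by
          rw [abs_mul, ← hκ2, ← sq_abs (u r), ← sq_abs (v r)]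
          nlinarith [sq_nonneg (κ * |u r| - |v r|)]
        have h6 : n / r * |v r * u r| ≤ κ * |v r * u r| :=
          mul_le_mul_of_nonneg_right hnr (abs_nonneg _)
        have h7 := mul_le_mul_of_nonneg_left (neg_abs_le (v r * u r)) hnr0
        linarith
      linarith
    have heq : 1 / (1 + (-flux ⊤ u r / (κ * u r)) ^ 2) *
        ((-(-g (u r) - n / r * flux ⊤ u r) * (κ * u r) - -flux ⊤ u r * (κ * prime ⊤ u r)) /
          (κ * u r) ^ 2) =
        κ * (u r * g (u r) + n / r * (v r * u r) + p r * v r) / (k * u r ^ 2 + v r ^ 2) := by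
      rw [← hκ2] at hD ⊢
      have : 1 + (-flux ⊤ u r / (κ * u r)) ^ 2 = (κ ^ 2 * u r ^ 2 + v r ^ 2) / (κ * u r) ^ 2 := by
        rw [eq_div_iff (by positivity)]
        field_simp
        ring
      rw [this]
      field_simp
      ring
    rw [heq, le_div_iff₀ hD]
    nlinarith
  choose! d hd hd' using hder
  have hmono : MonotoneOn (fun x => Real.arctan (-v x / (κ * u x)) - κ / 2 * x) (Ici a) := by
    have hdd : ∀ r ∈ Ici a, HasDerivAt (fun x => Real.arctan (-v x / (κ * u x)) - κ / 2 * x)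
        (d r - κ / 2) r := fun r hr =>
      (hd' r hr).sub (by simpa using (hasDerivAt_id r).const_mul (κ / 2))
    refine monotoneOn_of_hasDerivWithinAt_nonneg (convex_Ici a)
      (fun r hr => (hdd r hr).continuousAt.continuousWithinAt) (f' := fun r => d r - κ / 2)
      (fun r hr => (hdd r (interior_subset hr)).hasDerivWithinAt) fun r hr => ?_
    have := hd r (interior_subset hr)
    linarith
  -- Over this length the angle would gain `π`, more than the open range of `arctan` allows.
  have hb : a ≤ a + 2 * Real.pi / κ := by
    have := Real.pi_pos
    have : 0 < 2 * Real.pi / κ := by positivity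
    linarith
  have hle := hmono (mem_Ici.2 le_rfl) (mem_Ici.2 hb) hb
  have hlen : κ / 2 * (a + 2 * Real.pi / κ) = κ / 2 * a + Real.pi := by
    field_simp
  simp only at hle
  rw [hlen] at hle
  have h1 := Real.neg_pi_div_two_lt_arctan (-v a / (κ * u a))
  have h2 := Real.arctan_lt_pi_div_two
    (-v (a + 2 * Real.pi / κ) / (κ * u (a + 2 * Real.pi / κ)))
  linarith

lemma isOscillating (h : IsSolution (n + 1) g ξ ⊤ u) {k : ℝ} (hk : 0 < k)
    (hgk : ∀ r, 0 ≤ r → k * u r ^ 2 ≤ u r * g (u r)) : IsOscillating u := by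
  choose z hz hz0 hzu using fun m : ℕ => h.exists_zero_ge hk hgk m
  refine ⟨z, fun m => ⟨hz0 m, hzu m⟩, fun ⟨C, hC⟩ => ?_⟩
  obtain ⟨m, hm⟩ := exists_nat_gt C
  exact ((hm.trans_le (hz m)).trans_le (hC (mem_range_self m))).false

/-- The energy of a bounded global solution dissipates completely. -/
lemma exists_energy_lt_of_pos (h : IsSolution (n + 1) g ξ ⊤ u) (hg : Continuous g) (hn : n ≠ 0)
    {B C : ℝ} (hB : 0 ≤ B) (hu : ∀ r, 0 ≤ r → |u r| ≤ C)
    (hG0 : ∀ r, 0 ≤ r → 0 ≤ potential g (u r))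
    (hG : ∀ r, 0 ≤ r → potential g (u r) ≤ B * (u r * g (u r))) {e : ℝ} (he : 0 < e) :
    ∃ r, 0 ≤ r ∧ energy g ⊤ u r < e := by
  by_contra! hE
  have hI : ∀ r, 0 < r → r ∈ interval ⊤ := fun r hr => by rw [interval_top]; exact hr.le
  have hC : 0 ≤ C := (abs_nonneg _).trans (hu 0 le_rfl)
  set v := flux ⊤ u with hv
  set p := prime ⊤ u with hp
  set D := B * (n + 1) * C with hD
  have huv : ∀ r, 0 ≤ r → |u r * v r| ≤ C := fun r hr => by
    rw [abs_mul]
    calc |u r| * |v r| ≤ C * 1 :=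
          mul_le_mul (hu r hr) (abs_flux_lt_one r).le (abs_nonneg _) hC
      _ = C := mul_one C
  -- If `E ≥ e` throughout, `Ψ` is nonincreasing. The derivative of `B u v / r` contributes `-B u
  -- g(u) / r`, which controls the potential part of `E`; the friction in `(B + 1) E` controls the
  -- kinetic part and the extra `B u' v / r`. Together they pay for `e / r`, the derivative of `e
  -- log r`, while `D / r` absorbs the terms of order `r⁻²`. But `e log r` is unbounded and the
  -- other terms are bounded below.
  set Ψ : ℝ → ℝ := fun r =>
    (B + 1) * energy g ⊤ u r + B * (u r * v r / r) + e * Real.log r + D / r with hΨ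
  have hder : ∀ r, 0 < r → ∃ d ≤ 0, HasDerivAt Ψ d r := by
    intro r hr
    have h1 := (h.hasDerivAt_energy hg (hI r hr) hr).const_mul (B + 1)
    have h2 := ((((h.hasDerivAt (hI r hr) hr).mul (h.hasDerivAt_flux (hI r hr) hr)).div
      (hasDerivAt_id r) hr.ne')).const_mul B
    have h3 := (Real.hasDerivAt_log hr.ne').const_mul e
    have h4 := (hasDerivAt_const r D).div (hasDerivAt_id r) hr.ne'
    refine ⟨_, ?_, ((h1.add h2).add h3).add h4⟩
    simp only [id, Pi.mul_apply, mul_one, zero_mul, zero_sub]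
    have hvp : v r ^ 2 ≤ p r * v r := flux_sq_le r
    have hpv : 0 ≤ p r * v r := (sq_nonneg _).trans hvp
    have hkin := kinetic_le (R := ⊤) (u := u) r
    have hEr := hE r hr.le
    rw [energy] at hEr
    have hGr := hG r hr.le
    have hn1 : (1 : ℝ) ≤ n := by exact_mod_cast Nat.one_le_iff_ne_zero.2 hn
    have hmain : -((B + 1) * n * (p r * v r)) + B * (p r * v r) - B * (u r * g (u r)) + e ≤ 0 := by
      have : (B + 1) * (p r * v r) ≤ (B + 1) * n * (p r * v r) := by
        refine mul_le_mul_of_nonneg_right ?_ hpv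
        nlinarith
      linarith
    have hrest : -(B * (n + 1) * (u r * v r)) - D ≤ 0 := by
      have h5 := (abs_le.1 (huv r hr.le)).1
      have h6 : 0 ≤ B * (n + 1) := by positivity
      have := mul_le_mul_of_nonneg_left h5 h6
      rw [hD]
      linarith
    have heq : (B + 1) * -(n / r * (prime ⊤ u r * flux ⊤ u r)) +
        B * (((prime ⊤ u r * flux ⊤ u r + u r * (-g (u r) - n / r * flux ⊤ u r)) * r -
          u r * flux ⊤ u r) / r ^ 2) + e * r⁻¹ + -D / r ^ 2 =
        (-((B + 1) * n * (p r * v r)) + B * (p r * v r) - B * (u r * g (u r)) + e) / r +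
          (-(B * (n + 1) * (u r * v r)) - D) / r ^ 2 := by
      field_simp
      ring
    rw [heq]
    exact add_nonpos (div_nonpos_of_nonpos_of_nonneg hmain hr.le)
      (div_nonpos_of_nonpos_of_nonneg hrest (by positivity))
  choose! d hd hd' using hder
  have hanti : AntitoneOn Ψ (Ioi 0) := by
    refine antitoneOn_of_hasDerivWithinAt_nonpos (convex_Ioi 0)
      (fun r hr => (hd' r hr).continuousAt.continuousWithinAt) (f' := d)
      (fun r hr => (hd' r (interior_subset hr)).hasDerivWithinAt)
      fun r hr => hd r (interior_subset hr)
  have hlow : ∀ r, 1 ≤ r → e * Real.log r - B * C ≤ Ψ r := by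
    intro r hr
    have hr0 : 0 < r := by linarith
    have h1 : 0 ≤ (B + 1) * energy g ⊤ u r :=
      mul_nonneg (by linarith) ((hG0 r hr0.le).trans (potential_le_energy r))
    have h2 : 0 ≤ D / r := by positivity
    have h3 : -C ≤ u r * v r / r := by
      rw [le_div_iff₀ hr0]
      have := (abs_le.1 (huv r hr0.le)).1
      nlinarith
    have h4 := mul_le_mul_of_nonneg_left h3 hB
    simp only [hΨ]
    linarith
  obtain ⟨r, hr1, hr⟩ := ((eventually_ge_atTop 1).and
    (Real.tendsto_log_atTop.eventually_gt_atTop ((Ψ 1 + B * C) / e))).exists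
  rw [div_lt_iff₀ he] at hr
  have h1 := hanti (mem_Ioi.2 one_pos) (mem_Ioi.2 (by linarith)) hr1
  have h2 := hlow r hr1
  linarith

lemma hasDerivAt_slope_of_flux {v : ℝ} (hv : 0 < 1 - v ^ 2) :
    HasDerivAt (fun x : ℝ => x / Real.sqrt (1 - x ^ 2)) (1 / Real.sqrt (1 - v ^ 2) ^ 3) v := by
  have hs := Real.sqrt_pos.2 hv
  have h1 := ((hasDerivAt_pow 2 v).const_sub 1).sqrt hv.ne'
  have h2 : HasDerivAt (fun x : ℝ => x / Real.sqrt (1 - x ^ 2)) _ v :=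
    (hasDerivAt_id v).div h1 hs.ne'
  refine h2.congr_deriv ?_
  have hsq := Real.sq_sqrt hv.le
  simp only [id]
  field_simp
  push_cast
  rw [hsq]
  ring

/-- The energy dominates both `k u²` and `v² / 2`, and `u'` is a continuous function of `v` near
`0`. For `u''`, the chain rule brings in `v'`, which the equation expresses through `g (u)` and `v /
r`. -/
lemma isLocalized_of_energy (h : IsSolution (n + 1) g ξ ⊤ u) (hg : Continuous g)
    (hg0 : g 0 = 0) {k : ℝ} (hk : 0 < k) (hGk : ∀ r, 0 ≤ r → k * u r ^ 2 ≤ potential g (u r))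
    (hE : Tendsto (energy g ⊤ u) atTop (𝓝 0)) : IsLocalized u := by
  have hG0 : ∀ r, 0 ≤ r → 0 ≤ potential g (u r) := fun r hr =>
    (by positivity : 0 ≤ k * u r ^ 2).trans (hGk r hr)
  have hI : ∀ r, 0 < r → r ∈ interval ⊤ := fun r hr => by rw [interval_top]; exact hr.le
  have hsq : ∀ f : ℝ → ℝ, Tendsto (fun r => f r ^ 2) atTop (𝓝 0) → Tendsto f atTop (𝓝 0) := by
    intro f hf
    have := hf.sqrt
    simp only [Real.sqrt_sq_eq_abs, Real.sqrt_zero] at this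
    exact (tendsto_zero_iff_abs_tendsto_zero f).2 this
  have hu : Tendsto u atTop (𝓝 0) := by
    refine hsq u (squeeze_zero' (Eventually.of_forall fun r => sq_nonneg _) ?_
      (by simpa using hE.const_mul k⁻¹))
    filter_upwards [eventually_ge_atTop 0] with r hr
    have h1 := (hGk r hr).trans (potential_le_energy (R := ⊤) r)
    rw [inv_mul_eq_div, le_div_iff₀ hk]
    linarith
  have hv : Tendsto (flux ⊤ u) atTop (𝓝 0) := by
    refine hsq _ (squeeze_zero' (Eventually.of_forall fun r => sq_nonneg _) ?_
      (by simpa using hE.const_mul 2))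
    filter_upwards [eventually_ge_atTop 0] with r hr
    have h1 := hG0 r hr
    have h2 := le_kinetic (R := ⊤) (u := u) r
    rw [energy]
    linarith
  have hs : Tendsto (fun r => Real.sqrt (1 - flux ⊤ u r ^ 2)) atTop (𝓝 1) := by
    simpa using ((hv.pow 2).const_sub 1).sqrt
  refine ⟨hu, ?_, ?_⟩
  · have h1 := hv.div hs one_ne_zero
    rw [zero_div] at h1
    exact h1.congr fun r => (prime_eq r).symm
  · have hgu : Tendsto (fun r => g (u r)) atTop (𝓝 0) := by
      have := (hg.tendsto 0).comp hu
      rwa [hg0] at this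
    have hnr : Tendsto (fun r : ℝ => n / r) atTop (𝓝 0) := tendsto_const_nhds.div_atTop tendsto_id
    have h1 : Tendsto (fun r => 1 / Real.sqrt (1 - flux ⊤ u r ^ 2) ^ 3 *
        (-g (u r) - n / r * flux ⊤ u r)) atTop (𝓝 0) := by
      simpa using (((hs.pow 3).inv₀ (by norm_num))).mul (hgu.neg.sub (hnr.mul hv))
    refine h1.congr' ?_
    filter_upwards [eventually_gt_atTop 0] with r hr
    have h2 := (hasDerivAt_slope_of_flux (one_sub_flux_sq_pos (R := ⊤) (u := u) r)).comp r
      (h.hasDerivAt_flux (hI r hr) hr)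
    have h3 : HasDerivAt (prime ⊤ u) _ r :=
      h2.congr_of_eventuallyEq (Eventually.of_forall fun x => prime_eq x)
    exact (h3.hasDerivWithinAt.derivWithin (uniqueDiffOn_interval ⊤ r (hI r hr))).symm

end IsSolution

/-! ### Supremum norm and the small-energy case. -/

lemma supNorm_eq {u : ℝ → ℝ} {C : ℝ} (hc : ContinuousOn u (Ici 0)) (hu0 : |u 0| = C)
    (hu : ∀ r, 0 ≤ r → |u r| ≤ C) : supNorm u = ENNReal.ofReal C := by
  rw [supNorm, eLpNorm_exponent_top]
  refine le_antisymm (eLpNormEssSup_le_of_ae_bound ?_) ?_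
  · filter_upwards [ae_restrict_mem measurableSet_Ioi] with r hr
    exact hu r hr.le
  · by_contra! hlt
    -- The maximum sits at `0`, outside the domain of the norm; right continuity makes `|u|` exceed
    -- any smaller bound on an interval of positive measure.
    have hcont : ContinuousWithinAt (fun r => ‖u r‖ₑ) (Ici 0) 0 := (hc 0 self_mem_Ici).enorm
    have hgt : ∀ᶠ r in 𝓝[Ici 0] (0 : ℝ),
        eLpNormEssSup u (volume.restrict (Ioi 0)) < ‖u r‖ₑ := by
      refine hcont.eventually (lt_mem_nhds ?_)
      simp only
      rwa [Real.enorm_eq_ofReal_abs, hu0]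
    obtain ⟨δ, hδ, hball⟩ := mem_nhdsGE_iff_exists_Ico_subset.1 hgt
    have hδ : 0 < δ := hδ
    have hae := ae_le_eLpNormEssSup (f := u) (μ := volume.restrict (Ioi 0))
    rw [ae_restrict_iff' measurableSet_Ioi, ae_iff] at hae
    have hsub : Ioo 0 δ ⊆ {r | ¬(r ∈ Ioi 0 → ‖u r‖ₑ ≤ eLpNormEssSup u (volume.restrict (Ioi 0)))} := by
      intro r hr himp
      exact (hball ⟨hr.1.le, hr.2⟩ : _ < _).not_ge (himp hr.1)
    have := measure_mono_null hsub hae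
    rw [Real.volume_Ioo, sub_zero, ENNReal.ofReal_eq_zero] at this
    exact hδ.not_ge this

/-- Small-energy solutions are global, oscillating and localized, and their maximum modulus is
attained at the origin. -/
theorem IsMaximalSolution.oscillating_localized {n : ℕ} {g : ℝ → ℝ} {ξ : ℝ} {R : EReal}
    {u : ℝ → ℝ} (h : IsMaximalSolution (n + 1) g ξ R u) (hg : Continuous g) (hn : n ≠ 0)
    (hodd : ∀ t, g (-t) = -g t) (hdiff : DifferentiableAt ℝ g 0) (hderiv : 0 < deriv g 0)
    (hξ : 0 < ξ) {β : ℝ} (hβ : ξ < β) (hpos : ∀ t, 0 < t → t ≤ β → 0 < g t)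
    (hle : potential g ξ ≤ 1) :
    R = ⊤ ∧ IsOscillating u ∧ IsLocalized u ∧ supNorm u = ENNReal.ofReal ξ := by
  have hg0 : g 0 = 0 := by
    have := hodd 0
    rw [neg_zero] at this
    linarith
  obtain ⟨k, B, hk, hB, hquad⟩ :=
    exists_quadratic_bounds hg hodd hdiff hderiv (hξ.trans hβ).le hpos
  have habs : ∀ r ∈ interval R, |u r| ≤ ξ := fun r hr => h.1.abs_le_initial_value hg hodd hξ hβ hpos hr
  have hq : ∀ r ∈ interval R, _ := fun r hr => hquad (u r) ((habs r hr).trans hβ.le)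
  obtain rfl : R = ⊤ := h.endpoint_eq_top hg hn (hpos ξ hξ hβ.le)
    (fun r hr => (by positivity : 0 ≤ k / 2 * u r ^ 2).trans (hq r hr).2.1) hle
  have hsol := h.1
  rw [interval_top] at habs hq
  have hk2 : 0 < k / 2 := by positivity
  have hG0 : ∀ r, 0 ≤ r → 0 ≤ potential g (u r) := fun r hr =>
    (by positivity : 0 ≤ k / 2 * u r ^ 2).trans (hq r hr).2.1
  refine ⟨rfl, hsol.isOscillating hk fun r hr => (hq r hr).1,
    hsol.isLocalized_of_energy hg hg0 hk2 (fun r hr => (hq r hr).2.1) ?_, ?_⟩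
  · rw [Metric.tendsto_atTop]
    intro e he
    obtain ⟨r₀, hr₀, hlt⟩ := hsol.exists_energy_lt_of_pos hg hn hB.le habs hG0
      (fun r hr => (hq r hr).2.2) he
    have hanti := hsol.antitoneOn_energy hg
    rw [interval_top] at hanti
    refine ⟨r₀, fun r hr => ?_⟩
    have hr0 : 0 ≤ r := hr₀.trans hr
    rw [Real.dist_0_eq_abs, abs_of_nonneg ((hG0 r hr0).trans (IsSolution.potential_le_energy r))]
    exact (hanti hr₀ hr0 hr).trans_lt hlt
  · refine supNorm_eq ?_ ?_ habs
    · have := hsol.continuousOn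
      rwa [interval_top] at this
    · rw [hsol.initial_value, abs_of_pos hξ]

/-! ### Odd symmetry, equilibria and the case distinction on `ξ`. -/

lemma prime_neg (R : EReal) (u : ℝ → ℝ) : prime R (-u) = -prime R u :=
  funext fun _ => derivWithin.neg

lemma flux_neg_eq (R : EReal) (u : ℝ → ℝ) : flux R (-u) = -flux R u := by
  ext r
  simp [flux, prime_neg, neg_div]

lemma IsSolution.neg {N : ℕ} {g : ℝ → ℝ} {ξ : ℝ} {R : EReal} {u : ℝ → ℝ}
    (hodd : ∀ t, g (-t) = -g t) (h : IsSolution N g ξ R u) : IsSolution N g (-ξ) R (-u) where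
  endpoint_pos := h.endpoint_pos
  contDiffOn := h.contDiffOn.neg
  equation r hr h0 := by
    rw [flux_neg_eq, prime_neg, Pi.neg_apply, Pi.neg_apply, Pi.neg_apply, hodd, ← h.equation r hr h0]
    ring
  initial_value := by rw [Pi.neg_apply, h.initial_value]
  initial_slope := by rw [prime_neg, Pi.neg_apply, h.initial_slope, neg_zero]

lemma IsMaximalSolution.neg {N : ℕ} {g : ℝ → ℝ} {ξ : ℝ} {R : EReal} {u : ℝ → ℝ}
    (hodd : ∀ t, g (-t) = -g t) (h : IsMaximalSolution N g ξ R u) :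
    IsMaximalSolution N g (-ξ) R (-u) := by
  refine ⟨h.1.neg hodd, fun R' v hR hv heq => ?_⟩
  have hv' := hv.neg hodd
  rw [neg_neg] at hv'
  exact h.2 R' (-v) hR hv' fun r hr => by rw [Pi.neg_apply, heq hr, Pi.neg_apply, neg_neg]

lemma isMaximalSolution_const (N : ℕ) {g : ℝ → ℝ} {ξ : ℝ} (hξ : g ξ = 0) :
    IsMaximalSolution N g ξ ⊤ (fun _ => ξ) := by
  have hp : ∀ c : ℝ, prime ⊤ (fun _ => c) = fun _ => 0 := fun c =>
    funext fun r => congrFun (derivWithin_fun_const (interval ⊤) c) r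
  have hf : flux ⊤ (fun _ => ξ) = fun _ => 0 := by
    ext r
    simp [flux, hp]
  refine ⟨⟨EReal.zero_lt_top, contDiffOn_const, fun r _ _ => ?_, rfl, by rw [hp]⟩,
    fun R' v hR => absurd hR not_top_lt⟩
  rw [hf, hp, hξ]
  simp

lemma IsOscillating.neg {u : ℝ → ℝ} (h : IsOscillating u) : IsOscillating (-u) := by
  obtain ⟨z, hz, hb⟩ := h
  exact ⟨z, fun m => ⟨(hz m).1, by rw [Pi.neg_apply, (hz m).2, neg_zero]⟩, hb⟩

lemma IsLocalized.neg {u : ℝ → ℝ} (h : IsLocalized u) : IsLocalized (-u) := by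
  obtain ⟨h1, h2, h3⟩ := h
  rw [IsLocalized, prime_neg, prime_neg]
  have hneg : ∀ f : ℝ → ℝ, Tendsto f atTop (𝓝 0) → Tendsto (-f) atTop (𝓝 0) := fun f hf => by
    rw [← neg_zero]
    exact hf.neg
  exact ⟨hneg _ h1, hneg _ h2, hneg _ h3⟩

lemma supNorm_neg (u : ℝ → ℝ) : supNorm (-u) = supNorm u := eLpNorm_neg u _ _

lemma eq_zero_of_sign_change {g : ℝ → ℝ} (hg : Continuous g) {a : ℝ} (ha : 0 < a)
    (hpos : ∀ t, 0 < t → t < a → 0 < g t) (hneg : ∀ t, a < t → g t < 0) : g a = 0 := by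
  refine le_antisymm (le_of_tendsto (hg.continuousWithinAt (s := Ioi a) (x := a)).tendsto ?_)
    (ge_of_tendsto (hg.continuousWithinAt (s := Iio a) (x := a)).tendsto ?_)
  · filter_upwards [self_mem_nhdsWithin] with t ht using (hneg t ht).le
  · filter_upwards [Ioo_mem_nhdsLT ha] with t ht using (hpos t ht.1 ht.2).le

/-- The main result for positive initial values. -/
theorem exists_solution_of_pos {n : ℕ} (hn : n ≠ 0) {g : ℝ → ℝ} {α : EReal} (hg : Continuous g)
    (hodd : ∀ t, g (-t) = -g t) (hpos : ∀ t : ℝ, 0 < t → (t : EReal) < α → 0 < g t)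
    (hneg : ∀ t : ℝ, α < (t : EReal) → g t < 0) (hdiff : DifferentiableAt ℝ g 0)
    (hderiv : 0 < deriv g 0) {ξ : ℝ} (hα : 0 < α) (hξ : 0 < ξ) :
    ∃ (R : EReal) (u : ℝ → ℝ), IsMaximalSolution (n + 1) g ξ R u ∧
      ((ξ : EReal) = α → ∀ r ∈ interval R, u r = ξ) ∧
      (α < (ξ : EReal) → StrictMonoOn (fun r => |u r|) (interval R) ∧
        (Tendsto (fun r => |u r|) (leftLimit R) atTop ∨
          Tendsto (fun r => |prime R u r|) (leftLimit R) atTop)) ∧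
      ((ξ : EReal) < α → potential g ξ ≤ 1 →
        R = ⊤ ∧ IsOscillating u ∧ IsLocalized u ∧ supNorm u = ENNReal.ofReal ξ) := by
  rcases eq_or_ne (ξ : EReal) α with rfl | hne
  · have h0 : g ξ = 0 := eq_zero_of_sign_change hg hξ
      (fun t h1 h2 => hpos t h1 (by exact_mod_cast h2)) fun t ht => hneg t (by exact_mod_cast ht)
    exact ⟨⊤, fun _ => ξ, isMaximalSolution_const _ h0, fun _ _ _ => rfl,
      fun h => absurd h (lt_irrefl _), fun h => absurd h (lt_irrefl _)⟩
  · obtain ⟨R, u, hu⟩ := exists_isMaximalSolution n hg ξ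
    refine ⟨R, u, hu, fun h => absurd h hne, fun h => ?_, fun h hle => ?_⟩
    -- A threshold strictly between `α` and `ξ` gives `g < 0` on the closed half-line `[a, ∞)`,
    -- although `g α = 0` for finite `α`.
    · obtain ⟨a, ha1, ha2⟩ := EReal.lt_iff_exists_real_btwn.1 h
      exact hu.blow_up hg hn (by exact_mod_cast (hα.trans ha1).le) (by exact_mod_cast ha2)
        fun t ht => hneg t (ha1.trans_le (by exact_mod_cast ht))
    · obtain ⟨β, hβ1, hβ2⟩ := EReal.lt_iff_exists_real_btwn.1 h
      exact hu.oscillating_localized hg hn hodd hdiff hderiv hξ (by exact_mod_cast hβ1)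
        (fun t h0 ht => hpos t h0 (lt_of_le_of_lt (by exact_mod_cast ht) hβ2)) hle

end RadialMeanCurvature

theorem mainTheorem3 (N : ℕ) (hN : 2 ≤ N) (g : ℝ → ℝ) (α : EReal)
    (hg_cont : Continuous g)
    (hg_odd : ∀ t : ℝ, g (-t) = -g t)
    (hα : 0 < α)
    (hg_pos : ∀ t : ℝ, 0 < t → (t : EReal) < α → 0 < g t)
    (hg_neg : ∀ t : ℝ, α < (t : EReal) → g t < 0)
    (hg_diff : DifferentiableAt ℝ g 0)
    (hg_deriv : 0 < deriv g 0)
    (ξ : ℝ) :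
    ∃ (R : EReal) (u : ℝ → ℝ), RadialMeanCurvature.IsMaximalSolution N g ξ R u ∧
      (((|ξ| : ℝ) : EReal) = α ∨ ξ = 0 →
        ∀ r ∈ RadialMeanCurvature.interval R, u r = ξ) ∧
      (α < ((|ξ| : ℝ) : EReal) →
        StrictMonoOn (fun r => |u r|) (RadialMeanCurvature.interval R) ∧
        (Filter.Tendsto (fun r => |u r|) (RadialMeanCurvature.leftLimit R) Filter.atTop ∨
          Filter.Tendsto (fun r => |RadialMeanCurvature.prime R u r|)
            (RadialMeanCurvature.leftLimit R) Filter.atTop)) ∧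
      (0 < |ξ| → ((|ξ| : ℝ) : EReal) < α → (∫ s in (0 : ℝ)..ξ, g s) ≤ 1 →
        R = ⊤ ∧ RadialMeanCurvature.IsOscillating u ∧ RadialMeanCurvature.IsLocalized u ∧
        RadialMeanCurvature.supNorm u = ENNReal.ofReal |ξ|) := by
  obtain ⟨n, rfl⟩ : ∃ n, N = n + 1 := ⟨N - 1, by omega⟩
  have hn : n ≠ 0 := by omega
  rcases lt_trichotomy ξ 0 with hξ | rfl | hξ
  · obtain ⟨R, u, hu, h1, h2, h3⟩ := RadialMeanCurvature.exists_solution_of_pos hn hg_cont hg_odd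
      hg_pos hg_neg hg_diff hg_deriv hα (neg_pos.2 hξ)
    have hu' := hu.neg hg_odd
    rw [neg_neg] at hu'
    rw [abs_of_neg hξ]
    refine ⟨R, -u, hu', fun h r hr => ?_, fun h => ?_, fun _ h hle => ?_⟩
    · rw [Pi.neg_apply, h1 (h.resolve_right hξ.ne) r hr, neg_neg]
    · simpa [RadialMeanCurvature.prime_neg] using h2 h
    · obtain ⟨hR, ho, hl, hs⟩ := h3 h ((RadialMeanCurvature.potential_neg hg_odd ξ).trans_le hle)
      exact ⟨hR, ho.neg, hl.neg, by rw [RadialMeanCurvature.supNorm_neg, hs]⟩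
  · have h0 : g 0 = 0 := by
      have := hg_odd 0
      rw [neg_zero] at this
      linarith
    refine ⟨⊤, fun _ => 0, RadialMeanCurvature.isMaximalSolution_const _ h0, fun _ _ _ => rfl,
      fun h => ?_, fun h => ?_⟩
    · rw [abs_zero, EReal.coe_zero] at h
      exact absurd h hα.not_gt
    · rw [abs_zero] at h
      exact absurd h (lt_irrefl _)
  · obtain ⟨R, u, hu, h1, h2, h3⟩ := RadialMeanCurvature.exists_solution_of_pos hn hg_cont hg_odd
      hg_pos hg_neg hg_diff hg_deriv hα hξ
    rw [abs_of_pos hξ]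
    exact ⟨R, u, hu, fun h => h1 (h.resolve_right hξ.ne'), h2, fun _ => h3⟩
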